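/- Let $p$ be an odd prime, $K$ a field of characteristic $p$, and $G$ a cyclic group of order $q=p^\alpha$. Up to isomorphism there is, for each $1\le i\le q$, exactly one indecomposable $KG$-module $V_i$ of dimension $i$, and these are all the indecomposable $KG$-modules. For $1\le m\le n\le q$ the module $V_m\otimes_K V_n$ (with diagonal $G$-action) decomposes as $V_{\lambda_1}\oplus\dots\oplus V_{\lambda_m}$ with $\lambda_1\ge\dots\ge\lambda_m>0$, and the Jordan partition $\lambda(m,n,p)=(\lambda_1,\dots,\lambda_m)$ depends only on $m,n,p$. It is called standard if $\lambda_i=m+n-2i+1$ for all $1\le i\le m$. Theorem 2. Suppose that $p^t\le m<p^{t+1}$ with $t\ge 1$, and that $n\ge m$. Then $\lambda(m,n,p)$ is standard if and only if $$(m,n)=\Bigl(ip^t+\tfrac{p^t+\varepsilon}{2},\ jp^t+\tfrac{p^t+\varepsilon'}{2}+kp^{t+1}\Bigr)$$ for some signs $\varepsilon,\varepsilon'\in\{1,-1\}$ (chosen independently) and integers $i,j,k$ with $1\le i\le (p-1)/2$, $i\le j\le p-i-1$ and $k\ge 0$. -/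

import Mathlib

open scoped TensorProduct

noncomputable section

namespace JordanPartition

universe u v w w'

variable {K : Type u} {G : Type v} [Field K] [Group G]
variable {V : Type w} {W : Type w'} [AddCommGroup V] [Module K V] [AddCommGroup W] [Module K W]

/-- A `KG`-module is indecomposable if it is nonzero and is not the direct sum of two nonzero
`KG`-submodules. -/
def IsIndecomposable (ρ : Representation K G V) : Prop :=
  Nontrivial V ∧ ∀ A B : Subrepresentation ρ, IsCompl A B → A = ⊥ ∨ B = ⊥

/-- The `KG`-module `ρ` is an (internal) direct sum of indecomposable `KG`-submodules whose
dimensions are the entries of the list `l`. -/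
def HasDecomposition (ρ : Representation K G V) (l : List ℕ) : Prop :=
  ∃ U : Fin l.length → Subrepresentation ρ,
    DirectSum.IsInternal (fun i => (U i).toSubmodule) ∧
    ∀ i, IsIndecomposable (U i).toRepresentation ∧
      Module.finrank K (U i).toSubmodule = l.get i

open Classical in
/-- The nonincreasing list of the dimensions of the indecomposable summands of `ρ`. For a
finite-dimensional `ρ` it exists, and it is unique by the Krull-Schmidt theorem; the value `[]`
in the other branch is a default. -/
def indecomposableDims (ρ : Representation K G V) : List ℕ :=
  if h : ∃ l : List ℕ, l.SortedGE ∧ HasDecomposition ρ l then h.choose else []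

/-- The Jordan partition of the tensor product of two `KG`-modules: if `G` is a cyclic `p`-group,
`K` has characteristic `p`, and `ρ`, `σ` are indecomposable of dimensions `m ≤ n`, this is
`λ(m, n, p) = (λ₁, …, λₘ)`, where `ρ ⊗ σ` is the direct sum of indecomposable modules
of dimensions `λ₁ ≥ … ≥ λₘ`. -/
def jordanPartition (ρ : Representation K G V) (σ : Representation K G W) : List ℕ :=
  indecomposableDims (ρ.tprod σ)

/-- The list `l = (λ₁, …, λₘ)` is standard for `(m, n)`: it has `m` entries and
`λᵢ = m + n - 2 i + 1` for `1 ≤ i ≤ m` (the entry `λᵢ` is `l[i - 1]`). -/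
def IsStandard (m n : ℕ) (l : List ℕ) : Prop :=
  l.length = m ∧
    ∀ (i : ℕ) (hi : i < l.length), (l[i] : ℤ) = (m : ℤ) + n - 2 * ((i : ℤ) + 1) + 1

/-- The set of pairs `(i p^t + (p^t ± 1)/2, j p^t + (p^t ± 1)/2 + k p^(t+1))` with
`1 ≤ i ≤ (p - 1)/2`, `i ≤ j ≤ p - i - 1`, `k ≥ 0`; the two signs are independent.
(For odd `p` the divisions by two are exact.) -/
def standardPairs (p t : ℕ) : Set (ℕ × ℕ) :=
  {x | ∃ i j k c d : ℕ, 1 ≤ i ∧ i ≤ (p - 1) / 2 ∧ i ≤ j ∧ j ≤ p - i - 1 ∧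
    (c = (p ^ t - 1) / 2 ∨ c = (p ^ t + 1) / 2) ∧
    (d = (p ^ t - 1) / 2 ∨ d = (p ^ t + 1) / 2) ∧
    x = (i * p ^ t + c, j * p ^ t + d + k * p ^ (t + 1))}

end JordanPartition

end

/-!
Let `g` generate `G`. On `V ⊗ W` the endomorphism `g - 1` equals `X + Y` with `X = (g - 1) ⊗ g` and
`Y = 1 ⊗ (g - 1)`, and the commuting pair `X`, `Y` makes `V ⊗ W` a copy of
`K[x, y] / (x ^ m, y ^ n)`. So `λ(m, n, p)` is the Jordan type of `x + y` on this graded algebra.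
It is standard exactly when, for `1 ≤ r ≤ m`, multiplication by `(x + y) ^ (m + n - 2 r)` maps
degree `r - 1` isomorphically onto degree `m + n - 1 - r`. In suitable bases this map is a binomial
matrix whose determinant is the number of plane partitions in an `r × (m - r) × (n - r)` box, so
standardness means that none of these numbers is divisible by `p`.

By the box formula of MacMahon, the `p`-adic valuation of such a number is a sum of nonnegative
terms, one for each power `q = p ^ e`, and the term at `q` is periodic modulo `q` in every side of
the box. When `q ≤ m`, all terms at `q` vanish if and only if `m` and `n` are both congruent to
`(q ± 1) / 2` modulo `q`; when `m < q`, if and only if `m - 1 ≤ n mod q ≤ q + 1 - m`. The conditions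
at `q = p ^ t` and `q = p ^ (t + 1)` imply those at all other powers of `p`, and together they
describe the pairs in the theorem.
-/

namespace JordanPartition

/-! ### Arithmetic of the box numbers -/

/-- The sum of the quotients `j / q` over `j < n`: for `q = p ^ e`, the contribution of `q` to the
`p`-adic valuation of `∏_{j < n} j!`. -/
def sumDiv (q n : ℕ) : ℕ := ∑ j ∈ Finset.range n, j / q

/-- For `q = p ^ e`, the contribution of `q` to the `p`-adic valuation of the number of plane
partitions in an `r × b × c` box, as given by the box formula of MacMahon. -/
def boxExcess (q r b c : ℕ) : ℤ :=
  sumDiv q (b + c + r) + sumDiv q r + sumDiv q b + sumDiv q c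
    - sumDiv q (b + c) - sumDiv q (b + r) - sumDiv q (c + r)

/-- The boxes `r × (m - r) × (n - r)` with `1 ≤ r ≤ m` all have zero excess at `q`. -/
def BoxVanishes (q m n : ℕ) : Prop :=
  ∀ r, 1 ≤ r → r ≤ m → boxExcess q r (m - r) (n - r) = 0

/-- The residue of `x` modulo the odd number `q` is one of the two integers nearest to `q / 2`. -/
def IsNearHalf (q x : ℕ) : Prop :=
  x % q = (q - 1) / 2 ∨ x % q = (q + 1) / 2

lemma sumDiv_of_le {q n : ℕ} (h : n ≤ q) : sumDiv q n = 0 :=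
  Finset.sum_eq_zero fun _ hj => Nat.div_eq_of_lt ((Finset.mem_range.1 hj).trans_le h)

lemma sumDiv_add_self {q : ℕ} (hq : 0 < q) (n : ℕ) : sumDiv q (n + q) = sumDiv q n + n := by
  rw [add_comm n q, sumDiv, Finset.sum_range_add, ← sumDiv, sumDiv_of_le le_rfl]
  simp [Nat.add_div_left _ hq, Finset.sum_add_distrib, sumDiv]

lemma sumDiv_of_lt {q n : ℕ} (h : n < 3 * q) : sumDiv q n = (n - q) + (n - 2 * q) := by
  have hq : 0 < q := by omega
  rcases le_or_gt n q with h1 | h1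
  · rw [sumDiv_of_le h1]; omega
  obtain ⟨x, rfl⟩ := Nat.exists_eq_add_of_le' h1.le
  rw [sumDiv_add_self hq]
  rcases le_or_gt x q with h2 | h2
  · rw [sumDiv_of_le h2]; omega
  obtain ⟨y, rfl⟩ := Nat.exists_eq_add_of_le' h2.le
  rw [sumDiv_add_self hq, sumDiv_of_le (by omega)]
  omega

lemma boxExcess_left_comm (q r b c : ℕ) : boxExcess q r b c = boxExcess q b r c := by
  rw [boxExcess, boxExcess, show b + c + r = r + c + b by ring, add_comm b c, add_comm c r,
    add_comm b r]
  ring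

lemma boxExcess_right_comm (q r b c : ℕ) : boxExcess q r b c = boxExcess q r c b := by
  rw [boxExcess, boxExcess, add_comm b c]
  ring

lemma boxExcess_add_self {q : ℕ} (hq : 0 < q) (r b c : ℕ) :
    boxExcess q (r + q) b c = boxExcess q r b c := by
  simp only [boxExcess, ← add_assoc, sumDiv_add_self hq]
  push_cast
  ring

lemma boxExcess_mod_left {q : ℕ} (hq : 0 < q) (r b c : ℕ) :
    boxExcess q (r % q) b c = boxExcess q r b c :=
  Function.Periodic.map_mod_nat (f := (boxExcess q · b c)) (boxExcess_add_self hq · b c) r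

lemma boxExcess_mod {q : ℕ} (hq : 0 < q) (r b c : ℕ) :
    boxExcess q (r % q) (b % q) (c % q) = boxExcess q r b c := by
  rw [boxExcess_mod_left hq, boxExcess_left_comm, boxExcess_mod_left hq, boxExcess_left_comm,
    boxExcess_right_comm, boxExcess_left_comm, boxExcess_mod_left hq, boxExcess_left_comm,
    boxExcess_right_comm]

lemma boxExcess_congr {q r b c r' b' c' : ℕ} (hq : 0 < q) (hr : r ≡ r' [MOD q])
    (hb : b ≡ b' [MOD q]) (hc : c ≡ c' [MOD q]) : boxExcess q r b c = boxExcess q r' b' c' := by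
  rw [← boxExcess_mod hq, hr, hb, hc, boxExcess_mod hq]

lemma boxExcess_of_lt {q r b c : ℕ} (hr : r < q) (hb : b < q) (hc : c < q) :
    boxExcess q r b c = ((b + c + r - q + (b + c + r - 2 * q) : ℕ) : ℤ)
      - (b + c - q : ℕ) - (b + r - q : ℕ) - (c + r - q : ℕ) := by
  rw [boxExcess, sumDiv_of_lt (n := b + c + r) (by omega), sumDiv_of_lt (n := b + c) (by omega),
    sumDiv_of_lt (n := b + r) (by omega), sumDiv_of_lt (n := c + r) (by omega),
    sumDiv_of_le hr.le, sumDiv_of_le hb.le, sumDiv_of_le hc.le]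
  omega

lemma boxExcess_nonneg {q : ℕ} (hq : 0 < q) (r b c : ℕ) : 0 ≤ boxExcess q r b c := by
  have hr := Nat.mod_lt r hq
  have hb := Nat.mod_lt b hq
  have hc := Nat.mod_lt c hq
  rw [← boxExcess_mod hq, boxExcess_of_lt hr hb hc]
  omega

lemma boxExcess_eq_zero_of_add_le {q r b c : ℕ} (h : r + b + c ≤ q) : boxExcess q r b c = 0 := by
  simp only [boxExcess, sumDiv_of_le (show b + c + r ≤ q by omega),
    sumDiv_of_le (show r ≤ q by omega), sumDiv_of_le (show b ≤ q by omega),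
    sumDiv_of_le (show c ≤ q by omega), sumDiv_of_le (show b + c ≤ q by omega),
    sumDiv_of_le (show b + r ≤ q by omega), sumDiv_of_le (show c + r ≤ q by omega)]
  rfl

lemma exists_boxExcess_pos {q : ℕ} (hodd : Odd q) {x y : ℤ} (h : x.natAbs + y.natAbs + 1 < q) :
    ∃ r b c : ℕ, 1 ≤ r ∧ (r + b : ℤ) = q + x ∧ (r + c : ℤ) = q + y ∧
      0 < boxExcess q r b c := by
  obtain ⟨k, hk⟩ := hodd
  obtain ⟨d, hd⟩ := Int.even_or_odd' (x + y)
  have hpos : ∀ r b c : ℕ, r < q → b < q → c < q → (r + b : ℤ) = q + x → (r + c : ℤ) = q + y →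
      q ≤ b + c + 1 → b + c ≤ q + 1 → q < r + b + c → r + b + c < 2 * q →
      0 < boxExcess q r b c := by
    intro r b c hr hb hc _ _ _ _ _ _
    rw [boxExcess_of_lt hr hb hc]
    omega
  -- Imposing `b + c = q` or `b + c = q - 1`, according to parity, determines `r`, `b` and `c`.
  refine ⟨(k + d + 1).toNat, (k + x - d).toNat, (k + y - d).toNat, by omega, by omega, by omega,
    hpos _ _ _ ?_ ?_ ?_ ?_ ?_ ?_ ?_ ?_ ?_⟩ <;> omega

lemma not_boxVanishes_of_near {q m n u v : ℕ} {x y : ℤ} (hodd : Odd q) (hu : 1 ≤ u)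
    (hmn : m ≤ n) (hx : (m : ℤ) = u * q + x) (hy : (n : ℤ) = v * q + y)
    (h : x.natAbs + y.natAbs + 1 < q) : ¬ BoxVanishes q m n := by
  obtain ⟨r, b, c, hr, hrb, hrc, hpos⟩ := exists_boxExcess_pos hodd h
  have huv : u ≤ v := by
    by_contra! hlt
    have h1 : ((v : ℤ) + 1) * q ≤ u * q := by gcongr; exact_mod_cast hlt
    rw [add_mul, one_mul] at h1
    omega
  obtain ⟨u, rfl⟩ := Nat.exists_eq_add_of_le' hu
  obtain ⟨v, rfl⟩ := Nat.exists_eq_add_of_le huv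
  have hm : m = (r + q * u) + b := by push_cast at hx; zify; linarith
  have hn : n = (r + q * u) + (c + q * v) := by push_cast at hy; zify; linarith
  intro hvan
  have h0 := hvan (r + q * u) (by omega) (by omega)
  rw [hm, Nat.add_sub_cancel_left, hn, Nat.add_sub_cancel_left, boxExcess_congr (by omega)
    (Nat.add_mul_mod_self_left r q u) rfl (Nat.add_mul_mod_self_left c q v)] at h0
  omega

lemma add_mod_cases (q x y : ℕ) :
    x % q + y % q = (x + y) % q ∨ x % q + y % q = (x + y) % q + q := by
  rcases lt_or_ge (x % q + y % q) q with h | h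
  · exact .inl (Nat.add_mod_of_add_mod_lt h).symm
  · exact .inr (Nat.add_mod_add_of_le_add_mod h).symm

lemma boxVanishes_of_isNearHalf {q m n : ℕ} (hodd : Odd q) (hmn : m ≤ n) (hm : IsNearHalf q m)
    (hn : IsNearHalf q n) : BoxVanishes q m n := by
  intro r _ hrm
  have hq : 0 < q := hodd.pos
  obtain ⟨k, hk⟩ := hodd
  have hrb := add_mod_cases q r (m - r)
  have hrc := add_mod_cases q r (n - r)
  rw [Nat.add_sub_cancel' hrm] at hrb
  rw [Nat.add_sub_cancel' (hrm.trans hmn)] at hrc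
  have hr := Nat.mod_lt r hq
  have hb := Nat.mod_lt (m - r) hq
  have hc := Nat.mod_lt (n - r) hq
  rw [← boxExcess_mod hq, boxExcess_of_lt hr hb hc]
  unfold IsNearHalf at hm hn
  omega

lemma exists_eq_mul_add_of_odd {q x : ℕ} (hodd : Odd q) (hx : q ≤ x) :
    ∃ (u : ℕ) (y : ℤ), 1 ≤ u ∧ (x : ℤ) = u * q + y ∧ 2 * y.natAbs + 1 ≤ q ∧
      (2 * y.natAbs + 1 = q → IsNearHalf q x) := by
  have hlt := Nat.mod_lt x hodd.pos
  have hu : 1 ≤ x / q := (Nat.one_le_div_iff hodd.pos).2 hx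
  have hdiv := Nat.div_add_mod' x q
  obtain ⟨k, hk⟩ := hodd
  zify at hdiv
  unfold IsNearHalf
  rcases le_or_gt (x % q) k with h | h
  · exact ⟨x / q, (x % q : ℕ), hu, by push_cast; linarith, by omega, by omega⟩
  · exact ⟨x / q + 1, (x % q : ℕ) - q, by omega, by push_cast; linarith, by omega, by omega⟩

lemma boxVanishes_iff_isNearHalf {q m n : ℕ} (hodd : Odd q) (hqm : q ≤ m) (hmn : m ≤ n) :
    BoxVanishes q m n ↔ IsNearHalf q m ∧ IsNearHalf q n := by
  refine ⟨fun hvan => ?_, fun h => boxVanishes_of_isNearHalf hodd hmn h.1 h.2⟩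
  obtain ⟨u, x, hu, hx, hxq, hm⟩ := exists_eq_mul_add_of_odd hodd hqm
  obtain ⟨v, y, -, hy, hyq, hn⟩ := exists_eq_mul_add_of_odd hodd (hqm.trans hmn)
  have hfar : ¬ x.natAbs + y.natAbs + 1 < q := fun h =>
    not_boxVanishes_of_near hodd hu hmn hx hy h hvan
  exact ⟨hm (by omega), hn (by omega)⟩

lemma boxVanishes_of_lt {q m n : ℕ} (hmq : m < q) (hmn : m ≤ n)
    (hlo : m ≤ n % q + 1) (hhi : n % q + m ≤ q + 1) : BoxVanishes q m n := by
  intro r hr hrm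
  have hq : 0 < q := by omega
  have hrc := add_mod_cases q r (n - r)
  rw [Nat.add_sub_cancel' (hrm.trans hmn), Nat.mod_eq_of_lt (hrm.trans_lt hmq)] at hrc
  have hc := Nat.mod_lt (n - r) hq
  rw [boxExcess_congr hq rfl rfl (Nat.mod_modEq _ _).symm,
    boxExcess_of_lt (by omega) (by omega) hc]
  omega

lemma boxVanishes_iff_of_lt {q m n : ℕ} (hodd : Odd q) (hmq : m < q) (hmn : m ≤ n) :
    BoxVanishes q m n ↔ m ≤ n % q + 1 ∧ n % q + m ≤ q + 1 := by
  refine ⟨fun hvan => ?_, fun h => boxVanishes_of_lt hmq hmn h.1 h.2⟩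
  have hlt := Nat.mod_lt n hodd.pos
  have hdiv := Nat.div_add_mod' n q
  zify at hdiv
  constructor <;> by_contra! hcon
  · exact not_boxVanishes_of_near (u := 1) (v := n / q) (x := m - q) (y := (n % q : ℕ)) hodd le_rfl
      hmn (by push_cast; ring) (by push_cast; linarith) (by omega) hvan
  · exact not_boxVanishes_of_near (u := 1) (v := n / q + 1) (x := m - q) (y := (n % q : ℕ) - q)
      hodd le_rfl hmn (by push_cast; ring) (by push_cast; linarith) (by omega) hvan

lemma IsNearHalf.of_mul {q s x : ℕ} (hq : Odd q) (hs : Odd s) (hx : IsNearHalf (q * s) x) :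
    IsNearHalf q x := by
  have hmod : x % q = x % (q * s) % q := (Nat.mod_mul_right_mod x q s).symm
  obtain ⟨k, rfl⟩ := hq
  obtain ⟨l, rfl⟩ := hs
  have hmid : (2 * k + 1) * (2 * l + 1) = 2 * (k + (2 * k + 1) * l) + 1 := by ring
  rw [IsNearHalf, hmod]
  rcases hx with hx | hx
  · left
    rw [hx, hmid, show (2 * (k + (2 * k + 1) * l) + 1 - 1) / 2 = k + (2 * k + 1) * l by omega,
      Nat.add_mul_mod_self_left, Nat.mod_eq_of_lt (by omega)]
    omega
  · rw [hx, hmid, show (2 * (k + (2 * k + 1) * l) + 1 + 1) / 2 = k + 1 + (2 * k + 1) * l by omega,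
      Nat.add_mul_mod_self_left]
    rcases Nat.eq_zero_or_pos k with rfl | hk
    · exact .inl rfl
    · right; rw [Nat.mod_eq_of_lt (by omega)]; omega

lemma boxVanishes_mul {q s m n : ℕ} (hs : 0 < s) (hmq : m < q) (hmn : m ≤ n)
    (hlo : m ≤ n % q + 1) (hhi : n % q + m ≤ q + 1) : BoxVanishes (q * s) m n := by
  have hx : n / q % s + 1 ≤ s := Nat.mod_lt _ hs
  have hqx := Nat.mul_le_mul_left q hx
  rw [mul_add_one] at hqx
  have hmod : n % (q * s) = n % q + q * (n / q % s) := Nat.mod_mul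
  exact boxVanishes_of_lt (by nlinarith) hmn (by omega) (by omega)

lemma forall_boxVanishes_pow_iff {p m n t : ℕ} (hp : Odd p) (ht : 1 ≤ t) (hmt : p ^ t ≤ m)
    (hmt' : m < p ^ (t + 1)) (hmn : m ≤ n) :
    (∀ e, 1 ≤ e → BoxVanishes (p ^ e) m n) ↔
      (IsNearHalf (p ^ t) m ∧ IsNearHalf (p ^ t) n) ∧
        m ≤ n % p ^ (t + 1) + 1 ∧ n % p ^ (t + 1) + m ≤ p ^ (t + 1) + 1 := by
  constructor
  · exact fun h => ⟨(boxVanishes_iff_isNearHalf hp.pow hmt hmn).1 (h t ht),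
      (boxVanishes_iff_of_lt hp.pow hmt' hmn).1 (h (t + 1) (by omega))⟩
  · rintro ⟨⟨hm, hn⟩, hlo, hhi⟩ e -
    rcases le_or_gt e t with he | he
    · rw [← pow_mul_pow_sub p he] at hm hn
      exact boxVanishes_of_isNearHalf hp.pow hmn (hm.of_mul hp.pow hp.pow) (hn.of_mul hp.pow hp.pow)
    · rw [← pow_mul_pow_sub p (show t + 1 ≤ e from he)]
      exact boxVanishes_mul (pow_pos hp.pos _) hmt' hmn hlo hhi

lemma mem_standardPairs_iff {p m n t : ℕ} (hpt : 3 ≤ p ^ t) :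
    (m, n) ∈ standardPairs p t ↔ (IsNearHalf (p ^ t) m ∧ IsNearHalf (p ^ t) n) ∧
      1 ≤ m / p ^ t ∧ m / p ^ t ≤ n / p ^ t % p ∧ m / p ^ t + n / p ^ t % p < p := by
  constructor
  · rintro ⟨i, j, k, c, d, hi, -, hij, hj, hc, hd, heq⟩
    obtain ⟨rfl, rfl⟩ := Prod.mk.inj heq
    rw [pow_succ', show i * p ^ t + c = c + p ^ t * i by ring,
      show j * p ^ t + d + k * (p * p ^ t) = d + p ^ t * (j + p * k) by ring]
    have hcmod : (c + p ^ t * i) % p ^ t = c := by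
      rw [Nat.add_mul_mod_self_left, Nat.mod_eq_of_lt (by omega)]
    have hdmod : (d + p ^ t * (j + p * k)) % p ^ t = d := by
      rw [Nat.add_mul_mod_self_left, Nat.mod_eq_of_lt (by omega)]
    have hcdiv : (c + p ^ t * i) / p ^ t = i := by
      rw [Nat.add_mul_div_left _ _ (by omega), Nat.div_eq_of_lt (by omega), zero_add]
    have hddiv : (d + p ^ t * (j + p * k)) / p ^ t % p = j := by
      rw [Nat.add_mul_div_left _ _ (by omega), Nat.div_eq_of_lt (by omega), zero_add,
        Nat.add_mul_mod_self_left, Nat.mod_eq_of_lt (by omega)]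
    rw [IsNearHalf, IsNearHalf, hcmod, hdmod, hcdiv, hddiv]
    exact ⟨⟨hc, hd⟩, hi, hij, by omega⟩
  · rintro ⟨⟨hm, hn⟩, hi, hij, hj⟩
    refine ⟨m / p ^ t, n / p ^ t % p, n / p ^ t / p, m % p ^ t, n % p ^ t, hi, by omega, hij,
      by omega, hm, hn, ?_⟩
    rw [pow_succ', Nat.div_add_mod', add_right_comm, ← mul_assoc, ← add_mul, Nat.mod_add_div',
      Nat.div_add_mod']

lemma add_mul_le_add_mul_iff {q i j c d : ℕ} (hcd : c ≤ d + 1) (hdq : d + 1 < c + q) :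
    c + q * i ≤ d + q * j + 1 ↔ i ≤ j := by
  constructor
  · intro h
    by_contra! hji
    have := Nat.mul_le_mul_left q (Nat.succ_le_of_lt hji)
    rw [Nat.succ_eq_add_one, mul_add_one] at this
    omega
  · intro h
    have := Nat.mul_le_mul_left q h
    omega

lemma forall_boxVanishes_pow_iff_mem_standardPairs {p m n t : ℕ} (hp : Odd p) (ht : 1 ≤ t)
    (hmt : p ^ t ≤ m) (hmt' : m < p ^ (t + 1)) (hmn : m ≤ n) :
    (∀ e, 1 ≤ e → BoxVanishes (p ^ e) m n) ↔ (m, n) ∈ standardPairs p t := by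
  have hp3 : 3 ≤ p := by
    obtain ⟨k, rfl⟩ := hp
    rcases k.eq_zero_or_pos with rfl | hk
    · simp only [mul_zero, zero_add, one_pow] at hmt hmt'
      omega
    · omega
  have hpt : 3 ≤ p ^ t := hp3.trans (Nat.le_self_pow (by omega) p)
  rw [forall_boxVanishes_pow_iff hp ht hmt hmt' hmn, mem_standardPairs_iff hpt]
  refine and_congr_right fun ⟨hm, hn⟩ => ?_
  have hi : 1 ≤ m / p ^ t := (Nat.one_le_div_iff (by omega)).2 hmt
  have hmdiv := Nat.mod_add_div m (p ^ t)
  have hmod : n % p ^ (t + 1) = n % p ^ t + p ^ t * (n / p ^ t % p) := by rw [pow_succ, Nat.mod_mul]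
  obtain ⟨k, hk⟩ : Odd (p ^ t) := hp.pow
  unfold IsNearHalf at hm hn
  have hlo := add_mul_le_add_mul_iff (q := p ^ t) (i := m / p ^ t) (j := n / p ^ t % p)
    (c := m % p ^ t) (d := n % p ^ t) (by omega) (by omega)
  have hhi := add_mul_le_add_mul_iff (q := p ^ t) (i := m / p ^ t + n / p ^ t % p + 1) (j := p)
    (c := m % p ^ t + n % p ^ t) (d := p ^ t) (by omega) (by omega)
  rw [mul_add_one, mul_add, ← pow_succ] at hhi
  omega

/-! ### The box formula of MacMahon -/

section BoxFormula

open scoped Nat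

/-- The product `0! 1! ⋯ (n - 1)!`, the building block of the box formula of MacMahon. -/
def factorialProd (n : ℕ) : ℕ := ∏ j ∈ Finset.range n, j !

/-- The binomial matrix whose determinant counts plane partitions in an `r × b × c` box. -/
def boxMatrix (r b c : ℕ) : Matrix (Fin r) (Fin r) ℤ :=
  Matrix.of fun i j => ((b + c + j).choose (b + i) : ℤ)

lemma factorialProd_ne_zero (n : ℕ) : factorialProd n ≠ 0 :=
  Finset.prod_ne_zero_iff.2 fun j _ => j.factorial_ne_zero

lemma factorialProd_succ (n : ℕ) : factorialProd (n + 1) = factorialProd n * n ! :=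
  Finset.prod_range_succ _ n

lemma factorialProd_mul_prod (x r : ℕ) :
    factorialProd x * ∏ j : Fin r, (x + j)! = factorialProd (x + r) := by
  rw [factorialProd, factorialProd, Finset.prod_range_add, Finset.prod_range fun j => (x + j)!]

lemma choose_add_mul_factorial_mul_factorial (b c i j : ℕ) :
    (b + c + j).choose (b + i) * (b + i)! * (c + j)! = (b + c + j)! * (c + j).descFactorial i := by
  rcases le_or_gt i (c + j) with h | h
  · rw [← Nat.choose_mul_factorial_mul_factorial (show b + i ≤ b + c + j by omega),
      ← Nat.factorial_mul_descFactorial h, show b + c + j - (b + i) = c + j - i by omega]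
    ring
  · rw [Nat.choose_eq_zero_of_lt (by omega), Nat.descFactorial_of_lt h]
    simp

-- A Vandermonde determinant in the basis of falling factorials, at the nodes `c, …, c + r - 1`.
lemma det_descFactorial (r c : ℕ) :
    (Matrix.of fun i j : Fin r => ((c + j : ℕ).descFactorial i : ℤ)).det = factorialProd r := by
  have heval : (Matrix.of fun i j : Fin r => ((c + j : ℕ).descFactorial i : ℤ)).transpose
      = Matrix.of fun i j : Fin r => (descPochhammer ℤ j).eval ((i : ℤ) + c) := by
    ext i j
    rw [Matrix.transpose_apply, Matrix.of_apply, Matrix.of_apply,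
      ← descPochhammer_eval_eq_descFactorial, Nat.cast_add, add_comm]
  rw [← Matrix.det_transpose, heval, ← Matrix.det_eval_matrixOfPolynomials_eq_det_vandermonde _ _
    (fun i => descPochhammer_natDegree ℤ i) (fun i => monic_descPochhammer ℤ i),
    Matrix.det_vandermonde_add]
  cases r with
  | zero => simp [factorialProd]
  | succ n =>
    rw [Matrix.det_vandermonde_id_eq_superFactorial, ← Nat.prod_range_succ_factorial, factorialProd]

lemma det_boxMatrix_mul_prod (r b c : ℕ) :
    (boxMatrix r b c).det * ((∏ j : Fin r, (b + j)! : ℕ) * (∏ j : Fin r, (c + j)! : ℕ))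
      = (∏ j : Fin r, (b + c + j)! : ℕ) * factorialProd r := by
  have hentry : (Matrix.of fun i j : Fin r => ((c + j)! : ℤ) *
      (Matrix.of fun i j : Fin r => ((b + i)! : ℤ) * boxMatrix r b c i j) i j) =
      Matrix.of fun i j : Fin r => ((b + c + j)! : ℤ) *
        (Matrix.of fun i j : Fin r => ((c + j : ℕ).descFactorial i : ℤ)) i j := by
    ext i j
    have h := choose_add_mul_factorial_mul_factorial b c i j
    zify at h
    simp only [Matrix.of_apply, boxMatrix]
    linarith
  have hdet := congrArg Matrix.det hentry
  rw [Matrix.det_mul_row, Matrix.det_mul_column, Matrix.det_mul_row, det_descFactorial] at hdet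
  push_cast
  rw [← hdet]
  ring

-- The box formula of MacMahon, cleared of denominators.
lemma det_boxMatrix_mul (r b c : ℕ) :
    (boxMatrix r b c).det *
        (factorialProd (b + c) * factorialProd (b + r) * factorialProd (c + r) : ℕ)
      = (factorialProd (b + c + r) * factorialProd r * factorialProd b * factorialProd c : ℕ) := by
  have h := det_boxMatrix_mul_prod r b c
  rw [← factorialProd_mul_prod b r, ← factorialProd_mul_prod c r,
    ← factorialProd_mul_prod (b + c) r]
  push_cast at h ⊢
  linear_combination
    (factorialProd (b + c) * factorialProd b * factorialProd c : ℤ) * h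

lemma det_boxMatrix_ne_zero (r b c : ℕ) : (boxMatrix r b c).det ≠ 0 := by
  refine left_ne_zero_of_mul ((det_boxMatrix_mul r b c).trans_ne (Nat.cast_ne_zero.2 ?_))
  simp [factorialProd_ne_zero]

section Valuation

variable {p : ℕ} [Fact p.Prime]

lemma padicValNat_factorialProd {n B : ℕ} (hB : n < p ^ B) :
    padicValNat p (factorialProd n) = ∑ e ∈ Finset.Ico 1 B, sumDiv (p ^ e) n := by
  induction n with
  | zero => simp [factorialProd, sumDiv]
  | succ n ih =>
    have hlog : Nat.log p n < B :=
      Nat.log_lt_of_lt_pow' (by rintro rfl; simp at hB) (Nat.lt_of_succ_lt hB)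
    rw [factorialProd_succ, padicValNat.mul (factorialProd_ne_zero n) n.factorial_ne_zero,
      ih (Nat.lt_of_succ_lt hB), padicValNat_factorial hlog, ← Finset.sum_add_distrib]
    simp only [sumDiv, Finset.sum_range_succ]

lemma padicValInt_det_boxMatrix {r b c B : ℕ} (hB : b + c + r < p ^ B) :
    (padicValInt p (boxMatrix r b c).det : ℤ) =
      ∑ e ∈ Finset.Ico 1 B, boxExcess (p ^ e) r b c := by
  have h := congrArg (padicValInt p) (det_boxMatrix_mul r b c)
  have hF := factorialProd_ne_zero
  rw [padicValInt.mul (det_boxMatrix_ne_zero r b c) (by simp [hF]), padicValInt.of_nat,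
    padicValInt.of_nat] at h
  simp only [ne_eq, mul_eq_zero, hF, or_self, not_false_eq_true, padicValNat.mul] at h
  rw [padicValNat_factorialProd hB, padicValNat_factorialProd (n := r) (B := B) (by omega),
    padicValNat_factorialProd (n := b) (B := B) (by omega),
    padicValNat_factorialProd (n := c) (B := B) (by omega),
    padicValNat_factorialProd (n := b + c) (B := B) (by omega),
    padicValNat_factorialProd (n := b + r) (B := B) (by omega),
    padicValNat_factorialProd (n := c + r) (B := B) (by omega)] at h
  simp only [boxExcess, Finset.sum_sub_distrib, Finset.sum_add_distrib]
  zify at h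
  linarith

lemma prime_dvd_det_boxMatrix_iff (r b c : ℕ) :
    (p : ℤ) ∣ (boxMatrix r b c).det ↔ ∃ e, 1 ≤ e ∧ boxExcess (p ^ e) r b c ≠ 0 := by
  have hp : p.Prime := Fact.out
  have hB : b + c + r < p ^ (b + c + r) := Nat.lt_pow_self hp.one_lt
  have hnonneg e : 0 ≤ boxExcess (p ^ e) r b c := boxExcess_nonneg (pow_pos hp.pos e) r b c
  have hdvd := padicValInt_dvd_iff (p := p) 1 (boxMatrix r b c).det
  rw [pow_one, or_iff_right (det_boxMatrix_ne_zero r b c), Nat.one_le_iff_ne_zero,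
    ← Nat.cast_ne_zero (R := ℤ), padicValInt_det_boxMatrix hB, Ne,
    Finset.sum_eq_zero_iff_of_nonneg fun e _ => hnonneg e] at hdvd
  rw [hdvd]
  push Not
  refine exists_congr fun e => ⟨fun ⟨he, h⟩ => ⟨(Finset.mem_Ico.1 he).1, h⟩, fun ⟨he, h⟩ =>
    ⟨Finset.mem_Ico.2 ⟨he, ?_⟩, h⟩⟩
  by_contra! hBe
  have hle := Nat.pow_le_pow_right hp.pos hBe
  exact h (boxExcess_eq_zero_of_add_le (by omega))

lemma forall_det_boxMatrix_ne_zero_iff (p : ℕ) [Fact p.Prime] (R : Type*) [Ring R] [CharP R p]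
    (m n : ℕ) :
    (∀ r, 1 ≤ r → r ≤ m → ((boxMatrix r (m - r) (n - r)).det : R) ≠ 0) ↔
      ∀ e, 1 ≤ e → BoxVanishes (p ^ e) m n := by
  simp only [ne_eq, CharP.intCast_eq_zero_iff R p, prime_dvd_det_boxMatrix_iff, BoxVanishes]
  push Not
  exact ⟨fun h e he r hr hrm => h r hr hrm e he, fun h r hr hrm e he => h e he r hr hrm⟩

end Valuation

end BoxFormula

/-! ### Jordan chains of a nilpotent endomorphism -/

section JordanChains

variable {K M : Type*} [Field K] [AddCommGroup M] [Module K M] {T : Module.End K M}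

/-- The smallest `T`-invariant subspace containing `v`. -/
def cyclicSubspace (T : Module.End K M) (v : M) : Submodule K M :=
  Submodule.span K (Set.range fun k : ℕ => (T ^ k) v)

/-- The chains `w i, T (w i), …, T ^ (d i - 1) (w i)` form a Jordan basis of the nilpotent
endomorphism `T`. -/
structure IsJordanBasis {ι : Type*} (T : Module.End K M) (d : ι → ℕ) (w : ι → M) : Prop where
  pow_apply : ∀ i, (T ^ d i) (w i) = 0
  linearIndependent :
    LinearIndependent K fun x : (i : ι) × Fin (d i) => (T ^ (x.2 : ℕ)) (w x.1)
  span_eq_top :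
    Submodule.span K (Set.range fun x : (i : ι) × Fin (d i) => (T ^ (x.2 : ℕ)) (w x.1)) = ⊤

lemma pow_apply_eq_zero_of_le {x : M} {d e : ℕ} (h : (T ^ d) x = 0) (hde : d ≤ e) :
    (T ^ e) x = 0 := by
  rw [← Nat.sub_add_cancel hde, pow_add, Module.End.mul_apply, h, map_zero]

lemma cyclicSubspace_mem_invtSubmodule (T : Module.End K M) (v : M) :
    cyclicSubspace T v ∈ T.invtSubmodule := by
  rw [Module.End.mem_invtSubmodule, cyclicSubspace, Submodule.span_le]
  rintro _ ⟨k, rfl⟩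
  exact Submodule.subset_span ⟨k + 1, congrArg (· v) (pow_succ' T k)⟩

lemma cyclicSubspace_le {A : Submodule K M} (hA : A ∈ T.invtSubmodule) {v : M} (hv : v ∈ A) :
    cyclicSubspace T v ≤ A := by
  refine Submodule.span_le.2 (Set.range_subset_iff.2 fun k => ?_)
  induction k with
  | zero => exact hv
  | succ k ih => exact pow_succ' T k ▸ hA ih

lemma cyclicSubspace_eq_span_fin {v : M} {d : ℕ} (hv : (T ^ d) v = 0) :
    cyclicSubspace T v = Submodule.span K (Set.range fun k : Fin d => (T ^ (k : ℕ)) v) := by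
  refine le_antisymm (Submodule.span_le.2 ?_) (Submodule.span_mono ?_)
  · rintro _ ⟨k, rfl⟩
    rcases lt_or_ge k d with hk | hk
    · exact Submodule.subset_span ⟨⟨k, hk⟩, rfl⟩
    · simp [pow_apply_eq_zero_of_le hv hk]
  · rintro _ ⟨k, rfl⟩
    exact ⟨k, rfl⟩

-- In a vanishing combination, a suitable power of `T` isolates the last vectors of the chains
-- from which the nonzero coefficients are farthest away.
lemma linearIndependent_chains {ι : Type*} [Finite ι] {w : ι → M} {d : ι → ℕ}
    (hw : ∀ i, (T ^ d i) (w i) = 0) (hli : LinearIndependent K fun i => (T ^ (d i - 1)) (w i)) :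
    LinearIndependent K fun x : (i : ι) × Fin (d i) => (T ^ (x.2 : ℕ)) (w x.1) := by
  classical
  cases nonempty_fintype ι
  rw [Fintype.linearIndependent_iff]
  intro g hg
  by_contra! hne
  obtain ⟨y, hy⟩ := hne
  obtain ⟨x₀, hx₀, hmax⟩ := Finset.exists_max_image
    (Finset.univ.filter fun x : (i : ι) × Fin (d i) => g x ≠ 0) (fun x => d x.1 - x.2)
    ⟨y, by simpa using hy⟩
  have hlt := x₀.2.2
  set D := d x₀.1 - x₀.2 - 1
  have hterm : ∀ x : (i : ι) × Fin (d i), (T ^ D) (g x • (T ^ (x.2 : ℕ)) (w x.1))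
      = (if (x.2 : ℕ) + D + 1 = d x.1 then g x else 0) • (T ^ (d x.1 - 1)) (w x.1) := by
    intro x
    rw [map_smul, ← Module.End.mul_apply, ← pow_add]
    split_ifs with h
    · rw [show d x.1 - 1 = D + x.2 by omega]
    · rcases eq_or_ne (g x) 0 with h0 | h0
      · rw [h0, zero_smul, zero_smul]
      · have := hmax x (by simpa using h0)
        have := x.2.2
        rw [pow_apply_eq_zero_of_le (hw x.1) (by omega), smul_zero, zero_smul]
  have hsum := congrArg (T ^ D) hg
  simp only [map_sum, hterm, map_zero, Fintype.sum_sigma, ← Finset.sum_smul] at hsum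
  have h0 := Fintype.linearIndependent_iff.1 hli _ hsum x₀.1
  rw [Fintype.sum_eq_single x₀.2 fun k hk => if_neg fun h => hk (Fin.ext (by omega)),
    if_pos (by omega)] at h0
  exact (Finset.mem_filter.1 hx₀).2 h0

lemma linearIndependent_chain {v : M} {d : ℕ} (hv : (T ^ d) v = 0) (hv' : (T ^ (d - 1)) v ≠ 0) :
    LinearIndependent K fun k : Fin d => (T ^ (k : ℕ)) v :=
  (linearIndependent_chains (ι := Unit) (w := fun _ => v) (d := fun _ => d) (fun _ => hv)
    (.of_subsingleton () hv')).comp (Sigma.mk ()) sigma_mk_injective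

lemma finrank_cyclicSubspace {v : M} {d : ℕ} (hv : (T ^ d) v = 0) (hv' : (T ^ (d - 1)) v ≠ 0) :
    Module.finrank K (cyclicSubspace T v) = d := by
  rw [cyclicSubspace_eq_span_fin hv, finrank_span_eq_card (linearIndependent_chain hv hv'),
    Fintype.card_fin]

-- For a functional `φ` that does not vanish at the last vector of the chain, the largest invariant
-- subspace of `ker φ` is a complement.
lemma exists_isCompl_cyclicSubspace {v : M} {d : ℕ} (hT : T ^ d = 0)
    (hv : (T ^ (d - 1)) v ≠ 0) : ∃ B ∈ T.invtSubmodule, IsCompl (cyclicSubspace T v) B := by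
  have hpow : ∀ x, ∀ k ≥ d, (T ^ k) x = 0 := fun x _ hk =>
    pow_apply_eq_zero_of_le (LinearMap.congr_fun hT x) hk
  obtain ⟨φ, hφ⟩ := Module.Projective.exists_dual_ne_zero K hv
  let Φ : M →ₗ[K] (Fin d → K) := LinearMap.pi fun j => φ ∘ₗ T ^ (d - 1 - j)
  let A : Matrix (Fin d) (Fin d) K := Matrix.of fun i j => φ ((T ^ (d - 1 - j + i : ℕ)) v)
  have hA : A.det ≠ 0 := by
    have hupper : A.IsUpperTriangular := fun i j (hij : j < i) => by
      simp only [A, Matrix.of_apply]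
      rw [hpow v _ (by omega), map_zero]
    rw [Matrix.det_of_isUpperTriangular hupper, Finset.prod_ne_zero_iff]
    intro i _
    simpa [A, show d - 1 - i + i = d - 1 by omega] using hφ
  have hΦ : LinearIndependent K (Φ ∘ fun k : Fin d => (T ^ (k : ℕ)) v) := by
    have hrow : (Φ ∘ fun k : Fin d => (T ^ (k : ℕ)) v) = A.row := by
      ext i j
      simp [Φ, A, pow_add]
    exact hrow ▸ Matrix.linearIndependent_rows_of_det_ne_zero hA
  refine ⟨LinearMap.ker Φ, fun x hx => ?_, ?_, ?_⟩
  · refine LinearMap.mem_ker.2 (funext fun j => ?_)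
    simp only [Φ, LinearMap.pi_apply, LinearMap.comp_apply, ← Module.End.mul_apply, ← pow_succ]
    rcases Nat.eq_zero_or_pos j with hj | hj
    · rw [hpow x _ (by omega), map_zero, Pi.zero_apply]
    · have h := congrFun (LinearMap.mem_ker.1 hx) ⟨j - 1, by omega⟩
      simpa [Φ, show d - 1 - (j - 1) = d - 1 - j + 1 by omega] using h
  · rw [cyclicSubspace_eq_span_fin (hpow v d le_rfl)]
    exact Submodule.range_ker_disjoint hΦ
  · rw [codisjoint_iff, ← Submodule.comap_map_eq, cyclicSubspace_eq_span_fin (hpow v d le_rfl),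
      Submodule.map_span, ← Set.range_comp, hΦ.span_eq_top_of_card_eq_finrank' (by simp),
      Submodule.comap_top]

lemma exists_pow_pred_nilpotencyClass_ne_zero [Nontrivial M] (hT : IsNilpotent T) :
    ∃ v, (T ^ (nilpotencyClass T - 1)) v ≠ 0 := by
  by_contra! h
  exact pow_pred_nilpotencyClass hT (LinearMap.ext h)

lemma nilpotencyClass_eq_finrank_iff [FiniteDimensional K M] [Nontrivial M]
    (hT : IsNilpotent T) :
    nilpotencyClass T = Module.finrank K M ↔
      ∀ A ∈ T.invtSubmodule, ∀ B ∈ T.invtSubmodule, IsCompl A B → A = ⊥ ∨ B = ⊥ := by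
  obtain ⟨v, hv⟩ := exists_pow_pred_nilpotencyClass_ne_zero hT
  have hpow x : (T ^ nilpotencyClass T) x = 0 := LinearMap.congr_fun (pow_nilpotencyClass hT) x
  constructor
  · intro h A hA B hB hAB
    have htop : ∀ C ∈ T.invtSubmodule, ∀ x ∈ C, (T ^ (nilpotencyClass T - 1)) x ≠ 0 → C = ⊤ :=
      fun C hC x hx hx' => Submodule.eq_top_of_finrank_eq (le_antisymm (Submodule.finrank_le C)
        (by rw [← h, ← finrank_cyclicSubspace (hpow x) hx']
            exact Submodule.finrank_mono (cyclicSubspace_le hC hx)))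
    obtain ⟨a, ha, b, hb, rfl⟩ := Submodule.mem_sup.1
      (hAB.sup_eq_top ▸ Submodule.mem_top : v ∈ A ⊔ B)
    rw [map_add] at hv
    by_cases hA0 : (T ^ (nilpotencyClass T - 1)) a = 0
    · rw [hA0, zero_add] at hv
      exact .inl (eq_bot_of_isCompl_top (htop B hB b hb hv ▸ hAB))
    · exact .inr (eq_bot_of_top_isCompl (htop A hA a ha hA0 ▸ hAB))
  · intro h
    obtain ⟨B, hB, hcompl⟩ := exists_isCompl_cyclicSubspace (pow_nilpotencyClass hT) hv
    rcases h _ (cyclicSubspace_mem_invtSubmodule T v) B hB hcompl with h0 | rfl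
    · have hmem : v ∈ cyclicSubspace T v := Submodule.subset_span ⟨0, rfl⟩
      rw [h0, Submodule.mem_bot] at hmem
      exact absurd (by rw [hmem, map_zero]) hv
    · rw [← finrank_cyclicSubspace (hpow v) hv, eq_top_of_isCompl_bot hcompl, finrank_top]

lemma IsJordanBasis.finrank_range_pow {ι : Type*} [Fintype ι] {d : ι → ℕ} {w : ι → M}
    (h : IsJordanBasis T d w) (k : ℕ) :
    Module.finrank K (LinearMap.range (T ^ k)) = ∑ i, (d i - k) := by
  let shift : (i : ι) × Fin (d i - k) → (i : ι) × Fin (d i) :=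
    Sigma.map id fun i j => ⟨j + k, Nat.add_lt_of_lt_sub j.2⟩
  have hshift : Function.Injective shift :=
    Function.injective_id.sigma_map fun i j j' hj => Fin.ext (by simpa using hj)
  have hrange : LinearMap.range (T ^ k) = Submodule.span K (Set.range
      ((fun x : (i : ι) × Fin (d i) => (T ^ (x.2 : ℕ)) (w x.1)) ∘ shift)) := by
    rw [LinearMap.range_eq_map, ← h.span_eq_top, Submodule.map_span, ← Set.range_comp]
    refine le_antisymm (Submodule.span_le.2 ?_) (Submodule.span_mono ?_)
    · rintro _ ⟨⟨i, j⟩, rfl⟩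
      simp only [Function.comp_apply, SetLike.mem_coe]
      rw [← Module.End.mul_apply, ← pow_add, add_comm]
      rcases lt_or_ge (j + k : ℕ) (d i) with hlt | hge
      · exact Submodule.subset_span ⟨⟨i, ⟨j, by omega⟩⟩, rfl⟩
      · exact pow_apply_eq_zero_of_le (h.pow_apply i) hge ▸ zero_mem _
    · rintro _ ⟨⟨i, j⟩, rfl⟩
      refine ⟨⟨i, ⟨j, by omega⟩⟩, ?_⟩
      simp only [Function.comp_apply, shift, Sigma.map, id]
      rw [← Module.End.mul_apply, ← pow_add, add_comm]
  rw [hrange, finrank_span_eq_card (h.linearIndependent.comp shift hshift)]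
  simp

end JordanChains

lemma IsJordanBasis.isInternal_cyclicSubspace {K M ι : Type*} [Field K] [AddCommGroup M]
    [Module K M] [DecidableEq ι] {T : Module.End K M} {d : ι → ℕ} {w : ι → M}
    (h : IsJordanBasis T d w) : DirectSum.IsInternal fun i => cyclicSubspace T (w i) := by
  set f := fun x : (i : ι) × Fin (d i) => (T ^ (x.2 : ℕ)) (w x.1)
  have himage : ∀ i, cyclicSubspace T (w i) = Submodule.span K (f '' (Sigma.fst ⁻¹' {i})) :=
    fun i => by
      rw [cyclicSubspace_eq_span_fin (h.pow_apply i), ← Set.range_sigmaMk, ← Set.range_comp]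
      rfl
  rw [DirectSum.isInternal_submodule_iff_iSupIndep_and_iSup_eq_top]
  refine ⟨fun i => ?_, ?_⟩
  · have hle : ⨆ j, ⨆ _ : j ≠ i, cyclicSubspace T (w j)
        ≤ Submodule.span K (f '' (Sigma.fst ⁻¹' {i})ᶜ) := iSup₂_le fun j hj => by
      rw [himage]
      refine Submodule.span_mono (Set.image_mono ?_)
      rintro x rfl
      exact hj
    exact (himage i ▸ h.linearIndependent.disjoint_span_image disjoint_compl_right).mono_right hle
  · rw [eq_top_iff, ← h.span_eq_top, Submodule.span_le]
    rintro _ ⟨⟨i, k⟩, rfl⟩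
    exact Submodule.mem_iSup_of_mem i (Submodule.subset_span ⟨k, rfl⟩)

/-! ### Representations of a cyclic group -/

section Representations

variable {K G M : Type*} [Field K] [Group G] [AddCommGroup M] [Module K M]
  {τ : Representation K G M} {g : G}

lemma isNilpotent_sub_one {p a : ℕ} [Fact p.Prime] [CharP K p] (hG : Nat.card G = p ^ a)
    (τ : Representation K G M) (g : G) : IsNilpotent (τ g - 1) := by
  refine ⟨p ^ a, ?_⟩
  rcases subsingleton_or_nontrivial M with h | h
  · exact Subsingleton.elim _ _
  have : CharP (Module.End K M) p :=
    charP_of_injective_algebraMap (algebraMap K (Module.End K M)).injective p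
  rw [sub_pow_char_pow_of_commute _ _ (Commute.one_right _), ← map_pow, ← hG, pow_card_eq_one',
    map_one, one_pow, sub_self]

lemma toSubmodule_mem_invtSubmodule_sub_one (U : Subrepresentation τ) (g : G) :
    U.toSubmodule ∈ Module.End.invtSubmodule (τ g - 1) :=
  fun _ hx => sub_mem (U.apply_mem_toSubmodule g hx) hx

lemma apply_mem_of_mem_invtSubmodule_sub_one [Finite G] (hg : ∀ x, x ∈ Subgroup.zpowers g)
    {A : Submodule K M} (hA : A ∈ Module.End.invtSubmodule (τ g - 1)) (x : G) ⦃v : M⦄ (hv : v ∈ A) :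
    τ x v ∈ A := by
  obtain ⟨k, rfl⟩ := (Submonoid.mem_powers_iff _ _).1 (mem_powers_iff_mem_zpowers.2 (hg x))
  rw [map_pow]
  induction k with
  | zero => exact hv
  | succ k ih => simpa [pow_succ'] using add_mem (Submodule.mem_comap.1 (hA ih)) ih

lemma isIndecomposable_iff_nilpotencyClass_eq_finrank [Finite G] [FiniteDimensional K M]
    (hg : ∀ x, x ∈ Subgroup.zpowers g) (hN : IsNilpotent (τ g - 1)) :
    IsIndecomposable τ ↔
      Nontrivial M ∧ nilpotencyClass (τ g - 1) = Module.finrank K M := by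
  refine and_congr_right fun _ => ?_
  rw [nilpotencyClass_eq_finrank_iff hN]
  constructor
  · intro h A hA B hB hAB
    have h' := h ⟨A, apply_mem_of_mem_invtSubmodule_sub_one hg hA⟩
      ⟨B, apply_mem_of_mem_invtSubmodule_sub_one hg hB⟩
      ⟨disjoint_iff.2 (Subrepresentation.toSubmodule_injective hAB.inf_eq_bot),
        codisjoint_iff.2 (Subrepresentation.toSubmodule_injective hAB.sup_eq_top)⟩
    exact h'.imp (congrArg Subrepresentation.toSubmodule) (congrArg Subrepresentation.toSubmodule)
  · intro h A B hAB
    have h' := h _ (toSubmodule_mem_invtSubmodule_sub_one A g) _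
      (toSubmodule_mem_invtSubmodule_sub_one B g)
      ⟨disjoint_iff.2 (congrArg Subrepresentation.toSubmodule hAB.inf_eq_bot),
        codisjoint_iff.2 (congrArg Subrepresentation.toSubmodule hAB.sup_eq_top)⟩
    exact h'.imp (fun h => Subrepresentation.toSubmodule_injective h)
      (fun h => Subrepresentation.toSubmodule_injective h)

lemma IsIndecomposable.exists_cyclic_vector [Finite G] [FiniteDimensional K M]
    (hτ : IsIndecomposable τ) (hg : ∀ x, x ∈ Subgroup.zpowers g) (hN : IsNilpotent (τ g - 1)) :
    (τ g - 1) ^ Module.finrank K M = 0 ∧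
      ∃ v, ((τ g - 1) ^ (Module.finrank K M - 1)) v ≠ 0 := by
  obtain ⟨_, hclass⟩ := (isIndecomposable_iff_nilpotencyClass_eq_finrank hg hN).1 hτ
  rw [← hclass]
  exact ⟨pow_nilpotencyClass hN, exists_pow_pred_nilpotencyClass_ne_zero hN⟩

lemma coe_toRepresentation_sub_one_pow_apply (U : Subrepresentation τ) (g : G) (k : ℕ)
    (x : U.toSubmodule) : (((U.toRepresentation g - 1) ^ k) x : M) = ((τ g - 1) ^ k) x := by
  induction k with
  | zero => rfl
  | succ k ih =>
    rw [pow_succ', pow_succ', Module.End.mul_apply, Module.End.mul_apply, ← ih]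
    rfl

lemma isNilpotent_toRepresentation_sub_one (hN : IsNilpotent (τ g - 1))
    (U : Subrepresentation τ) : IsNilpotent (U.toRepresentation g - 1) := by
  obtain ⟨k, hk⟩ := hN
  refine ⟨k, LinearMap.ext fun x => Subtype.ext ?_⟩
  rw [coe_toRepresentation_sub_one_pow_apply, hk]
  rfl

lemma isIndecomposable_of_toSubmodule_eq_cyclicSubspace [Finite G] [FiniteDimensional K M]
    (hg : ∀ x, x ∈ Subgroup.zpowers g) {U : Subrepresentation τ} {v : M} {d : ℕ}
    (hU : U.toSubmodule = cyclicSubspace (τ g - 1) v) (hv : ((τ g - 1) ^ d) v = 0)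
    (hv' : ((τ g - 1) ^ (d - 1)) v ≠ 0) : IsIndecomposable U.toRepresentation := by
  have hd : d - 1 + 1 = d := Nat.sub_add_cancel <| Nat.one_le_iff_ne_zero.2 fun h0 =>
    hv' (by simpa [h0] using hv)
  have hfin : Module.finrank K U.toSubmodule = d := hU ▸ finrank_cyclicSubspace hv hv'
  have hmem : v ∈ U.toSubmodule := hU ▸ Submodule.subset_span ⟨0, rfl⟩
  have hle : U.toSubmodule ≤ LinearMap.ker ((τ g - 1) ^ d) := by
    refine hU ▸ cyclicSubspace_le (fun x hx => ?_) (LinearMap.mem_ker.2 hv)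
    rw [Submodule.mem_comap, LinearMap.mem_ker, ← Module.End.mul_apply, ← pow_succ, pow_succ',
      Module.End.mul_apply, LinearMap.mem_ker.1 hx, map_zero]
  have hpow : (U.toRepresentation g - 1) ^ d = 0 := LinearMap.ext fun x => Subtype.ext <| by
    rw [coe_toRepresentation_sub_one_pow_apply]
    exact hle x.2
  rw [isIndecomposable_iff_nilpotencyClass_eq_finrank hg ⟨d, hpow⟩, hfin, ← hd,
    nilpotencyClass_eq_succ_iff, hd]
  refine ⟨Module.nontrivial_of_finrank_pos (R := K) (by omega), hpow, fun h0 => hv' ?_⟩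
  rw [← coe_toRepresentation_sub_one_pow_apply U g (d - 1) ⟨v, hmem⟩, h0]
  rfl

lemma IsJordanBasis.hasDecomposition [Finite G] [FiniteDimensional K M]
    (hg : ∀ x, x ∈ Subgroup.zpowers g) {l : List ℕ} (hpos : ∀ i, 1 ≤ l.get i)
    {w : Fin l.length → M} (h : IsJordanBasis (τ g - 1) l.get w) : HasDecomposition τ l := by
  have hw : ∀ i, ((τ g - 1) ^ (l.get i - 1)) (w i) ≠ 0 := fun i =>
    h.linearIndependent.ne_zero ⟨i, ⟨l.get i - 1, Nat.sub_lt (hpos i) one_pos⟩⟩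
  refine ⟨fun i => ⟨cyclicSubspace (τ g - 1) (w i), apply_mem_of_mem_invtSubmodule_sub_one hg
    (cyclicSubspace_mem_invtSubmodule _ _)⟩, h.isInternal_cyclicSubspace, fun i =>
      ⟨isIndecomposable_of_toSubmodule_eq_cyclicSubspace hg rfl (h.pow_apply i) (hw i),
        finrank_cyclicSubspace (h.pow_apply i) (hw i)⟩⟩

lemma HasDecomposition.one_le_get [FiniteDimensional K M] {l : List ℕ}
    (h : HasDecomposition τ l) (i : Fin l.length) : 1 ≤ l.get i := by
  obtain ⟨U, -, hU⟩ := h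
  have := (hU i).1.1
  exact (hU i).2 ▸ Module.finrank_pos

lemma HasDecomposition.exists_isJordanBasis [Finite G] [FiniteDimensional K M]
    (hg : ∀ x, x ∈ Subgroup.zpowers g) (hN : IsNilpotent (τ g - 1)) {l : List ℕ}
    (h : HasDecomposition τ l) : ∃ w, IsJordanBasis (τ g - 1) l.get w := by
  have hpos := h.one_le_get
  obtain ⟨U, hU, hUi⟩ := h
  choose hT v hv using fun i =>
    (hUi i).1.exists_cyclic_vector hg (isNilpotent_toRepresentation_sub_one hN (U i))
  simp only [(hUi _).2] at hT hv
  have hpow : ∀ i, (((U i).toRepresentation g - 1) ^ l.get i) (v i) = 0 := fun i => by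
    rw [hT, LinearMap.zero_apply]
  let b : ∀ i, Module.Basis (Fin (l.get i)) K (U i).toSubmodule := fun i =>
    have : Nonempty (Fin (l.get i)) := ⟨⟨0, hpos i⟩⟩
    basisOfLinearIndependentOfCardEqFinrank (linearIndependent_chain (hpow i) (hv i))
      (by rw [Fintype.card_fin, (hUi i).2])
  have hb : ⇑(hU.collectedBasis b) = fun x : (i : Fin l.length) × Fin (l.get i) =>
      ((τ g - 1) ^ (x.2 : ℕ)) (v x.1 : M) := by
    ext x
    simp [b, DirectSum.IsInternal.collectedBasis_coe, coe_toRepresentation_sub_one_pow_apply]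
  refine ⟨fun i => v i, ⟨fun i => ?_, hb ▸ (hU.collectedBasis b).linearIndependent,
    hb ▸ (hU.collectedBasis b).span_eq⟩⟩
  rw [← coe_toRepresentation_sub_one_pow_apply, hpow, ZeroMemClass.coe_zero]

end Representations

/-! ### Jordan partitions -/

section JordanPartitions

lemma count_add_two_mul_sum_tsub (l : List ℕ) {x : ℕ} (hx : 1 ≤ x) :
    l.count x + 2 * ∑ i, (l.get i - x)
      = ∑ i, (l.get i - (x - 1)) + ∑ i, (l.get i - (x + 1)) := by
  induction l with
  | nil => rfl
  | cons y l ih =>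
    have hcons : ∀ k, ∑ i, ((y :: l).get i - k) = (y - k) + ∑ i, (l.get i - k) :=
      fun k => Fin.sum_univ_succ _
    rw [hcons, hcons, hcons, List.count_cons]
    simp only [beq_iff_eq]
    split_ifs <;> omega

lemma list_eq_of_sum_tsub_eq {l l' : List ℕ} (hl : l.SortedGE) (hl' : l'.SortedGE)
    (hpos : ∀ i, 1 ≤ l.get i) (hpos' : ∀ i, 1 ≤ l'.get i)
    (h : ∀ k, ∑ i, (l.get i - k) = ∑ i, (l'.get i - k)) : l = l' := by
  have hzero : ∀ l : List ℕ, (∀ i, 1 ≤ l.get i) → l.count 0 = 0 := fun l hpos =>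
    List.count_eq_zero_of_not_mem fun h0 => by
      obtain ⟨i, hi⟩ := List.get_of_mem h0
      exact absurd (hpos i) (by omega)
  refine List.Perm.eq_of_sortedGE hl hl' (List.perm_iff_count.2 fun x => ?_)
  rcases Nat.eq_zero_or_pos x with rfl | hx
  · rw [hzero l hpos, hzero l' hpos']
  · have h1 := count_add_two_mul_sum_tsub l hx
    have h2 := count_add_two_mul_sum_tsub l' hx
    rw [h, h, h] at h1
    omega

variable {K G M : Type*} [Field K] [Group G] [AddCommGroup M] [Module K M]
  {τ : Representation K G M} {g : G} {l : List ℕ}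

lemma hasDecomposition_indecomposableDims (h : indecomposableDims τ ≠ []) :
    HasDecomposition τ (indecomposableDims τ) := by
  unfold indecomposableDims at h ⊢
  split_ifs at h ⊢ with hex
  · exact hex.choose_spec.2
  · exact absurd rfl h

lemma indecomposableDims_eq [Finite G] [FiniteDimensional K M]
    (hg : ∀ x, x ∈ Subgroup.zpowers g) (hN : IsNilpotent (τ g - 1)) (hl : l.SortedGE)
    (h : HasDecomposition τ l) : indecomposableDims τ = l := by
  have hex : ∃ l : List ℕ, l.SortedGE ∧ HasDecomposition τ l := ⟨l, hl, h⟩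
  rw [indecomposableDims, dif_pos hex]
  obtain ⟨hl', h'⟩ := hex.choose_spec
  obtain ⟨w, hw⟩ := h.exists_isJordanBasis hg hN
  obtain ⟨w', hw'⟩ := h'.exists_isJordanBasis hg hN
  exact list_eq_of_sum_tsub_eq hl' hl h'.one_le_get h.one_le_get fun k => by
    rw [← hw'.finrank_range_pow, ← hw.finrank_range_pow]

/-- The standard Jordan partition `(m + n - 1, m + n - 3, …, n - m + 1)` for `m ≤ n`, indexed
from zero. -/
def standardDim (m n : ℕ) (i : Fin m) : ℕ := m + n - 1 - 2 * i

lemma isStandard_iff_eq_ofFn_standardDim {m n : ℕ} (hmn : m ≤ n) :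
    IsStandard m n l ↔ l = List.ofFn (standardDim m n) := by
  constructor
  · rintro ⟨rfl, h⟩
    refine List.ext_getElem (by simp) fun i hi _ => ?_
    have := h i hi
    simp only [List.getElem_ofFn, standardDim]
    omega
  · rintro rfl
    refine ⟨List.length_ofFn, fun i hi => ?_⟩
    rw [List.length_ofFn] at hi
    simp only [List.getElem_ofFn, standardDim]
    omega

lemma sortedGE_ofFn_standardDim (m n : ℕ) : (List.ofFn (standardDim m n)).SortedGE :=
  List.sortedGE_ofFn_iff.2 fun _ _ hij =>
    Nat.sub_le_sub_left (Nat.mul_le_mul_left 2 hij) _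

lemma isStandard_indecomposableDims_iff_hasDecomposition [Finite G] [FiniteDimensional K M]
    (hg : ∀ x, x ∈ Subgroup.zpowers g) (hN : IsNilpotent (τ g - 1)) {m n : ℕ} (hm : 1 ≤ m)
    (hmn : m ≤ n) : IsStandard m n (indecomposableDims τ) ↔
      HasDecomposition τ (List.ofFn (standardDim m n)) := by
  rw [isStandard_iff_eq_ofFn_standardDim hmn]
  refine ⟨fun h => h ▸ hasDecomposition_indecomposableDims ?_,
    indecomposableDims_eq hg hN (sortedGE_ofFn_standardDim m n)⟩
  rw [h, Ne, List.ofFn_eq_nil_iff]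
  omega

lemma exists_isJordanBasis_get_ofFn_iff {T : Module.End K M} {m : ℕ} (d : Fin m → ℕ) :
    (∃ w, IsJordanBasis T (List.ofFn d).get w) ↔ ∃ w, IsJordanBasis T d w := by
  have hcast : ∀ {k} (h : k = m) {d' : Fin k → ℕ}, d' = d ∘ Fin.cast h →
      ((∃ w, IsJordanBasis T d' w) ↔ ∃ w, IsJordanBasis T d w) := by
    rintro _ rfl _ rfl
    rfl
  exact hcast List.length_ofFn (funext fun i => List.get_ofFn d i)

lemma isStandard_indecomposableDims_iff_exists_isJordanBasis [Finite G] [FiniteDimensional K M]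
    (hg : ∀ x, x ∈ Subgroup.zpowers g) (hN : IsNilpotent (τ g - 1)) {m n : ℕ} (hm : 1 ≤ m)
    (hmn : m ≤ n) : IsStandard m n (indecomposableDims τ) ↔
      ∃ w, IsJordanBasis (τ g - 1) (standardDim m n) w := by
  rw [isStandard_indecomposableDims_iff_hasDecomposition hg hN hm hmn,
    ← exists_isJordanBasis_get_ofFn_iff]
  refine ⟨fun h => h.exists_isJordanBasis hg hN, fun ⟨w, hw⟩ => hw.hasDecomposition hg fun i => ?_⟩
  have := i.2.trans_eq List.length_ofFn
  rw [List.get_ofFn, standardDim, Fin.val_cast]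
  omega

end JordanPartitions

/-! ### The algebra `K[x, y] / (x ^ m, y ^ n)` -/

section Bicyclic

variable {K M : Type*} [Field K] [AddCommGroup M] [Module K M] {X Y : Module.End K M} {u : M}

/-- The image of the space of homogeneous polynomials of degree `d` under the evaluation map
`K[x, y] → M`, `f ↦ f(X, Y) u`, for commuting `X` and `Y`. -/
def homogeneousSpan (X Y : Module.End K M) (u : M) (d : ℕ) : Submodule K M :=
  Submodule.span K (Set.range fun i : Fin (d + 1) => (X ^ (i : ℕ) * Y ^ (d - i)) u)

lemma monomial_mem_homogeneousSpan (X Y : Module.End K M) (u : M) {a b d : ℕ} (h : a + b = d) :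
    (X ^ a * Y ^ b) u ∈ homogeneousSpan X Y u d := by
  subst h
  exact Submodule.subset_span ⟨⟨a, by omega⟩, by simp⟩

lemma homogeneousSpan_le {d : ℕ} {A : Submodule K M} :
    homogeneousSpan X Y u d ≤ A ↔ ∀ a b, a + b = d → (X ^ a * Y ^ b) u ∈ A := by
  refine ⟨fun h a b hab => h (monomial_mem_homogeneousSpan X Y u hab), fun h => ?_⟩
  exact Submodule.span_le.2 (Set.range_subset_iff.2 fun i => h _ _ (by omega))

lemma finrank_homogeneousSpan_le (X Y : Module.End K M) (u : M) (d : ℕ) :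
    Module.finrank K (homogeneousSpan X Y u d) ≤ d + 1 :=
  (finrank_range_le_card _).trans (Fintype.card_fin _).le

lemma map_homogeneousSpan_le_left (d : ℕ) :
    (homogeneousSpan X Y u d).map X ≤ homogeneousSpan X Y u (d + 1) := by
  rw [Submodule.map_le_iff_le_comap, homogeneousSpan_le]
  intro a b hab
  rw [Submodule.mem_comap, ← Module.End.mul_apply, ← mul_assoc, ← pow_succ']
  exact monomial_mem_homogeneousSpan X Y u (by omega)

lemma map_homogeneousSpan_le_right (hXY : Commute X Y) (d : ℕ) :
    (homogeneousSpan X Y u d).map Y ≤ homogeneousSpan X Y u (d + 1) := by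
  rw [Submodule.map_le_iff_le_comap, homogeneousSpan_le]
  intro a b hab
  rw [Submodule.mem_comap, ← Module.End.mul_apply, ← mul_assoc, (hXY.symm.pow_right a).eq,
    mul_assoc, ← pow_succ']
  exact monomial_mem_homogeneousSpan X Y u (by omega)

lemma map_add_smul_pow_homogeneousSpan_le (hXY : Commute X Y) (c : K) (d k : ℕ) :
    (homogeneousSpan X Y u d).map ((X + c • Y) ^ k) ≤ homogeneousSpan X Y u (d + k) := by
  induction k with
  | zero => exact (Submodule.map_id _).le
  | succ k ih =>
    rw [pow_succ', Module.End.mul_eq_comp, Submodule.map_comp]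
    refine (Submodule.map_mono ih).trans ?_
    rintro _ ⟨x, hx, rfl⟩
    exact add_mem (map_homogeneousSpan_le_left _ ⟨x, hx, rfl⟩)
      (Submodule.smul_mem _ c (map_homogeneousSpan_le_right hXY _ ⟨x, hx, rfl⟩))

lemma homogeneousSpan_add_smul_le (hXY : Commute X Y) (c : K) (d : ℕ) :
    homogeneousSpan (X + c • Y) Y u d ≤ homogeneousSpan X Y u d := by
  rw [homogeneousSpan_le]
  rintro a b rfl
  rw [add_comm]
  refine map_add_smul_pow_homogeneousSpan_le hXY c b a ⟨(Y ^ b) u, ?_, rfl⟩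
  simpa using monomial_mem_homogeneousSpan X Y u (zero_add b)

lemma homogeneousSpan_le_homogeneousSpan_add (hXY : Commute X Y) (d : ℕ) :
    homogeneousSpan X Y u d ≤ homogeneousSpan (X + Y) Y u d := by
  simpa using homogeneousSpan_add_smul_le (u := u) (hXY.add_left (Commute.refl Y)) (-1 : K) d

/-- `M` is isomorphic to `K[x, y] / (x ^ m, y ^ n)` as a module over `K[x, y]`, where `x` and `y`
act through `X` and `Y`, and `u` corresponds to `1`. -/
structure IsBicyclic (X Y : Module.End K M) (u : M) (m n : ℕ) : Prop where
  commute : Commute X Y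
  left_pow : X ^ m = 0
  right_pow : Y ^ n = 0
  linearIndependent :
    LinearIndependent K fun x : Fin m × Fin n => (X ^ (x.1 : ℕ) * Y ^ (x.2 : ℕ)) u
  span_eq_top :
    Submodule.span K (Set.range fun x : Fin m × Fin n => (X ^ (x.1 : ℕ) * Y ^ (x.2 : ℕ)) u) = ⊤

namespace IsBicyclic

variable {m n : ℕ}

lemma monomial_eq_zero (h : IsBicyclic X Y u m n) {a b : ℕ} (hab : m ≤ a ∨ n ≤ b) :
    X ^ a * Y ^ b = 0 := by
  rcases hab with ha | hb
  · rw [pow_eq_zero_of_le ha h.left_pow, zero_mul]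
  · rw [pow_eq_zero_of_le hb h.right_pow, mul_zero]

lemma finiteDimensional (h : IsBicyclic X Y u m n) : FiniteDimensional K M :=
  Module.Finite.of_basis (Module.Basis.mk h.linearIndependent h.span_eq_top.ge)

lemma finrank_eq (h : IsBicyclic X Y u m n) : Module.finrank K M = m * n := by
  simp [Module.finrank_eq_card_basis (Module.Basis.mk h.linearIndependent h.span_eq_top.ge)]

lemma add_pow_mul_monomial (h : IsBicyclic X Y u m n) (N a b : ℕ) :
    (X + Y) ^ N * (X ^ a * Y ^ b)
      = ∑ k ∈ Finset.range (N + 1), (N.choose k : K) • (X ^ (k + a) * Y ^ (N - k + b)) := by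
  rw [h.commute.add_pow, Finset.sum_mul]
  refine Finset.sum_congr rfl fun k _ => ?_
  rw [← nsmul_eq_mul', ← Nat.cast_smul_eq_nsmul K, smul_mul_assoc, pow_add, pow_add, mul_assoc,
    mul_assoc, ← mul_assoc (Y ^ (N - k)), (h.commute.symm.pow_pow (N - k) a).eq, mul_assoc]

-- In degree `m + n - 1 - r`, only the monomials `X ^ (m - r + i) * Y ^ (n - 1 - i)` with `i < r`
-- are nonzero.
lemma add_pow_mul_pow (h : IsBicyclic X Y u m n) {r j : ℕ} (hrm : r ≤ m) (hrn : r ≤ n)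
    (hj : j < r) : (X + Y) ^ (m - r + (n - r) + j) * Y ^ (r - 1 - j) = ∑ i : Fin r,
      (((m - r + (n - r) + j).choose (m - r + i) : ℕ) : K) •
        (X ^ (m - r + i) * Y ^ (n - 1 - i)) := by
  have hexpand := h.add_pow_mul_monomial (m - r + (n - r) + j) 0 (r - 1 - j)
  rw [pow_zero, one_mul] at hexpand
  rw [hexpand, ← Finset.sum_range fun i =>
    (((m - r + (n - r) + j).choose (m - r + i) : ℕ) : K) • (X ^ (m - r + i) * Y ^ (n - 1 - i))]
  have hshift := Finset.sum_Ico_eq_sum_range (fun k => ((m - r + (n - r) + j).choose k : K)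
    • (X ^ k * Y ^ (m - r + (n - 1) - k))) (m - r) (m - r + r)
  simp only [Nat.add_sub_cancel_left, Nat.add_sub_add_left] at hshift
  rw [← hshift]
  refine Finset.sum_congr_of_eq_on_inter (fun k hk hk' => ?_) (fun k _ hk => ?_) fun k hk hk' => ?_
  all_goals simp only [Finset.mem_range, Finset.mem_Ico] at *
  · rw [h.monomial_eq_zero (by omega), smul_zero]
  · rw [Nat.choose_eq_zero_of_lt (by omega), Nat.cast_zero, zero_smul]
  · rw [add_zero, show m - r + (n - r) + j - k + (r - 1 - j) = m - r + (n - 1) - k by omega]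

lemma add_pow_comp_linearCombination (h : IsBicyclic X Y u m n) {r : ℕ} (hrm : r ≤ m)
    (hrn : r ≤ n) :
    ((X + Y) ^ (m - r + (n - r))) ∘ₗ
        Fintype.linearCombination K (fun j : Fin r => ((X + Y) ^ (j : ℕ) * Y ^ (r - 1 - j)) u)
      = Fintype.linearCombination K (fun i : Fin r => (X ^ (m - r + i) * Y ^ (n - 1 - i)) u) ∘ₗ
        Matrix.toLin' ((boxMatrix r (m - r) (n - r)).map ((↑) : ℤ → K)) := by
  refine LinearMap.pi_ext' fun j => LinearMap.ext_ring ?_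
  simp only [LinearMap.comp_apply, LinearMap.single_apply, Matrix.toLin'_apply,
    Matrix.mulVec_single_one, Fintype.linearCombination_apply_single, one_smul]
  rw [← Module.End.mul_apply, ← mul_assoc, ← pow_add, h.add_pow_mul_pow hrm hrn j.2,
    Fintype.linearCombination_apply]
  simp [boxMatrix]

end IsBicyclic

/-- The alternating sum of the monomials of degree `m + n - 1 - r` in `K[x, y] / (x ^ m, y ^ n)`.
It is annihilated by `x + y`, and it is the last vector of the standard Jordan chain of length
`m + n + 1 - 2 * r`. -/
def socleVector (X Y : Module.End K M) (u : M) (m n r : ℕ) : M :=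
  ∑ i ∈ Finset.range r, (-1 : K) ^ i • (X ^ (m - r + i) * Y ^ (n - 1 - i)) u

namespace IsBicyclic

variable {m n : ℕ}

lemma add_apply_socleVector (h : IsBicyclic X Y u m n) {r : ℕ} (hrm : r ≤ m) (hrn : r ≤ n) :
    (X + Y) (socleVector X Y u m n r) = 0 := by
  have hstep : ∀ i ∈ Finset.range r,
      (X + Y) ((-1 : K) ^ i • (X ^ (m - r + i) * Y ^ (n - 1 - i)) u)
        = (-1 : K) ^ i • (X ^ (m - r + i) * Y ^ (n - i)) u
          - (-1 : K) ^ (i + 1) • (X ^ (m - r + (i + 1)) * Y ^ (n - (i + 1))) u := by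
    intro i hi
    rw [Finset.mem_range] at hi
    have hX : X * (X ^ (m - r + i) * Y ^ (n - 1 - i))
        = X ^ (m - r + (i + 1)) * Y ^ (n - (i + 1)) := by
      rw [← mul_assoc, ← pow_succ', add_assoc, Nat.sub_sub, add_comm 1 i]
    have hY : Y * (X ^ (m - r + i) * Y ^ (n - 1 - i)) = X ^ (m - r + i) * Y ^ (n - i) := by
      rw [← mul_assoc, (h.commute.symm.pow_right _).eq, mul_assoc, ← pow_succ',
        show n - 1 - i + 1 = n - i by omega]
    rw [map_smul, LinearMap.add_apply, ← Module.End.mul_apply, ← Module.End.mul_apply, hX, hY,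
      pow_succ, mul_neg_one, neg_smul, sub_neg_eq_add, smul_add, add_comm]
  rw [socleVector, map_sum, Finset.sum_congr rfl hstep, Finset.sum_range_sub' fun i =>
    (-1 : K) ^ i • (X ^ (m - r + i) * Y ^ (n - i)) u, h.monomial_eq_zero (.inr (by omega)),
    h.monomial_eq_zero (.inl (by omega))]
  simp

lemma exists_pow_apply_eq_socleVector (h : IsBicyclic X Y u m n) {r : ℕ} (hrm : r ≤ m)
    (hrn : r ≤ n) (hdet : ((boxMatrix r (m - r) (n - r)).det : K) ≠ 0) :
    ∃ w, ((X + Y) ^ (m - r + (n - r))) w = socleVector X Y u m n r := by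
  rw [Int.cast_det, ← isUnit_iff_ne_zero] at hdet
  set A := (boxMatrix r (m - r) (n - r)).map ((↑) : ℤ → K)
  have hsolve := LinearMap.congr_fun (h.add_pow_comp_linearCombination hrm hrn)
    (A⁻¹.mulVec fun i => (-1) ^ (i : ℕ))
  rw [LinearMap.comp_apply, LinearMap.comp_apply, Matrix.toLin'_apply, Matrix.mulVec_mulVec,
    Matrix.mul_nonsing_inv _ hdet, Matrix.one_mulVec] at hsolve
  refine ⟨_, hsolve.trans ?_⟩
  rw [socleVector, Finset.sum_range, Fintype.linearCombination_apply]

lemma linearIndependent_socleVector (h : IsBicyclic X Y u m n) (hmn : m ≤ n) :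
    LinearIndependent K fun i : Fin m => socleVector X Y u m n (i + 1) := by
  let B := Module.Basis.mk h.linearIndependent h.span_eq_top.ge
  have hcoord : ∀ (x : Fin m × Fin n) {a b : ℕ}, a < m → b < n →
      B.coord x ((X ^ a * Y ^ b) u) = if a = x.1 ∧ b = x.2 then 1 else 0 := by
    intro x a b ha hb
    have hB : (X ^ a * Y ^ b) u = B (⟨a, ha⟩, ⟨b, hb⟩) := by simp [B]
    rw [hB, Module.Basis.coord_apply, Module.Basis.repr_self, Finsupp.single_apply]
    simp only [Prod.ext_iff, Fin.ext_iff]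
  let top : Fin m → Fin m × Fin n := fun i =>
    (⟨m - (i + 1), Nat.sub_lt (Fin.pos i) i.1.succ_pos⟩,
      ⟨n - 1, Nat.sub_one_lt ((Fin.pos i).trans_le hmn).ne'⟩)
  have hdual : ∀ i j : Fin m,
      B.coord (top i) (socleVector X Y u m n (j + 1)) = if i = j then 1 else 0 := by
    intro i j
    have := j.2
    rw [socleVector, map_sum, Finset.sum_eq_single 0]
    · rw [map_smul, pow_zero, one_smul, hcoord (top i) (by omega) (by omega)]
      have htop : m - (j + 1 : ℕ) + 0 = m - (i + 1) ∧ n - 1 - 0 = n - 1 ↔ i = j := by omega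
      simp only [top, htop]
    · intro k hk hk0
      rw [Finset.mem_range] at hk
      rw [map_smul, hcoord (top i) (by omega) (by omega), if_neg (by simp only [top]; omega),
        smul_zero]
    · simp
  exact LinearIndependent.of_pairwise_dual_eq_zero_one _ (fun i => B.coord (top i))
    (fun i j hij => (hdual i j).trans (if_neg hij)) fun i => (hdual i i).trans (if_pos rfl)

end IsBicyclic

lemma sum_range_odd_add (c r : ℕ) :
    ∑ i ∈ Finset.range r, (c + 2 * r - 1 - 2 * i) = r * (c + r) := by
  induction r with
  | zero => simp
  | succ r ih =>
    have hshift : ∀ i, c + 2 * (r + 1) - 1 - 2 * (i + 1) = c + 2 * r - 1 - 2 * i := by omega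
    rw [Finset.sum_range_succ', Finset.sum_congr rfl fun i _ => hshift i, ih,
      show c + 2 * (r + 1) - 1 - 2 * 0 = c + 2 * r + 1 by omega]
    ring

lemma sum_standardDim {m n : ℕ} (hmn : m ≤ n) : ∑ i, standardDim m n i = m * n := by
  obtain ⟨c, rfl⟩ := Nat.exists_eq_add_of_le' hmn
  rw [← sum_range_odd_add, Finset.sum_range]
  refine Finset.sum_congr rfl fun i _ => ?_
  rw [standardDim]
  omega

lemma sum_standardDim_tsub {m n r : ℕ} (hrm : r ≤ m) (hmn : m ≤ n) :
    ∑ i, (standardDim m n i - (m - r + (n - r))) = r * r := by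
  have hlow := sum_range_odd_add 0 r
  simp only [zero_add] at hlow
  simp only [standardDim, ← Finset.sum_range fun i => m + n - 1 - 2 * i - (m - r + (n - r))]
  rw [← hlow, ← Finset.sum_subset (Finset.range_mono hrm) fun i _ hi => ?_]
  · exact Finset.sum_congr rfl fun i _ => by omega
  · rw [Finset.mem_range] at hi
    omega

lemma IsBicyclic.exists_isJordanBasis {m n : ℕ} (h : IsBicyclic X Y u m n) (hmn : m ≤ n)
    (hdet : ∀ r, 1 ≤ r → r ≤ m → ((boxMatrix r (m - r) (n - r)).det : K) ≠ 0) :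
    ∃ w, IsJordanBasis (X + Y) (standardDim m n) w := by
  choose w hw using fun i : Fin m =>
    h.exists_pow_apply_eq_socleVector i.2 (Nat.le_trans i.2 hmn) (hdet _ (by omega) i.2)
  have hdim : ∀ i : Fin m, standardDim m n i = m - (i + 1) + (n - (i + 1)) + 1 := fun i => by
    rw [standardDim]
    omega
  have hpow : ∀ i, ((X + Y) ^ standardDim m n i) (w i) = 0 := fun i => by
    rw [hdim, pow_succ', Module.End.mul_apply, hw]
    exact h.add_apply_socleVector i.2 (Nat.le_trans i.2 hmn)
  have hlast : ∀ i, ((X + Y) ^ (standardDim m n i - 1)) (w i) = socleVector X Y u m n (i + 1) :=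
    fun i => by rw [hdim, Nat.add_sub_cancel, hw]
  have hli := linearIndependent_chains hpow
    (by simpa only [hlast] using h.linearIndependent_socleVector hmn)
  have := h.finiteDimensional
  refine ⟨w, hpow, hli, hli.span_eq_top_of_card_eq_finrank' ?_⟩
  simp only [Fintype.card_sigma, Fintype.card_fin, sum_standardDim hmn, h.finrank_eq]

lemma finrank_finset_sup_le {ι : Type*} [FiniteDimensional K M] (s : Finset ι)
    (A : ι → Submodule K M) :
    Module.finrank K (s.sup A : Submodule K M) ≤ ∑ i ∈ s, Module.finrank K (A i) := by
  classical
  induction s using Finset.induction_on with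
  | empty => simp
  | insert i s hi ih =>
    rw [Finset.sup_insert, Finset.sum_insert hi]
    exact (Submodule.finrank_add_le_finrank_add_finrank _ _).trans (Nat.add_le_add_left ih _)

lemma sum_range_min (r : ℕ) :
    ∑ d ∈ Finset.range (2 * r - 1), min (d + 1) (2 * r - 1 - d) = r * r := by
  induction r with
  | zero => rfl
  | succ r ih =>
    rcases r.eq_zero_or_pos with rfl | hr
    · rfl
    have hmin : ∀ d ∈ Finset.range (2 * r - 1),
        min (d + 1 + 1) (2 * r + 1 - (d + 1)) = min (d + 1) (2 * r - 1 - d) + 1 := by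
      intro d hd
      rw [Finset.mem_range] at hd
      omega
    rw [show 2 * (r + 1) - 1 = 2 * r - 1 + 1 + 1 by omega, Finset.sum_range_succ,
      Finset.sum_range_succ', show 2 * r - 1 + 1 + 1 = 2 * r + 1 by omega,
      Finset.sum_congr rfl hmin, Finset.sum_add_distrib, ih, Finset.sum_const, Finset.card_range,
      smul_eq_mul, mul_one, show 2 * r - 1 + 1 = 2 * r by omega,
      show min (0 + 1) (2 * r + 1 - 0) = 1 by omega,
      show min (2 * r + 1) (2 * r + 1 - 2 * r) = 1 by omega, add_mul, mul_add]
    omega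

namespace IsBicyclic

variable {m n : ℕ}

lemma finrank_homogeneousSpan_le_sub (h : IsBicyclic X Y u m n) (d : ℕ) :
    Module.finrank K (homogeneousSpan X Y u d) ≤ m + n - 1 - d := by
  classical
  have := h.finiteDimensional
  have hle : homogeneousSpan X Y u d ≤ Submodule.span K
      ((Finset.Ico (d + 1 - n) m).image fun a => (X ^ a * Y ^ (d - a)) u : Finset M) := by
    rw [homogeneousSpan_le]
    intro a b hab
    by_cases hzero : m ≤ a ∨ n ≤ b
    · exact h.monomial_eq_zero hzero ▸ zero_mem _
    · refine Submodule.subset_span (Finset.mem_coe.2 (Finset.mem_image.2 ⟨a, ?_, ?_⟩))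
      · rw [Finset.mem_Ico]
        omega
      · rw [← hab, Nat.add_sub_cancel_left]
  refine ((Submodule.finrank_mono hle).trans (finrank_span_finset_le_card _)).trans ?_
  refine Finset.card_image_le.trans ?_
  rw [Nat.card_Ico]
  omega

lemma iSup_homogeneousSpan_eq_top (h : IsBicyclic X Y u m n) :
    ⨆ d, homogeneousSpan X Y u d = ⊤ := by
  rw [eq_top_iff, ← h.span_eq_top, Submodule.span_le, Set.range_subset_iff]
  exact fun x => Submodule.mem_iSup_of_mem _ (monomial_mem_homogeneousSpan X Y u rfl)

lemma finrank_map_add_pow_homogeneousSpan_le (h : IsBicyclic X Y u m n) (s d : ℕ) :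
    Module.finrank K ((homogeneousSpan X Y u d).map ((X + Y) ^ s))
      ≤ min (d + 1) (m + n - 1 - (d + s)) := by
  have := h.finiteDimensional
  refine le_min ((Submodule.finrank_map_le _ _).trans (finrank_homogeneousSpan_le X Y u d)) ?_
  have hmap := map_add_smul_pow_homogeneousSpan_le (u := u) h.commute (1 : K) d s
  rw [one_smul] at hmap
  exact (Submodule.finrank_mono hmap).trans (h.finrank_homogeneousSpan_le_sub _)

lemma finrank_map_add_pow_homogeneousSpan_lt (h : IsBicyclic X Y u m n) {r : ℕ} (hr : 1 ≤ r)
    (hrm : r ≤ m) (hrn : r ≤ n) (hdet : ((boxMatrix r (m - r) (n - r)).det : K) = 0) :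
    Module.finrank K ((homogeneousSpan X Y u (r - 1)).map ((X + Y) ^ (m - r + (n - r)))) < r := by
  have := h.finiteDimensional
  have hrange : homogeneousSpan X Y u (r - 1) ≤ LinearMap.range (Fintype.linearCombination K
      fun j : Fin r => ((X + Y) ^ (j : ℕ) * Y ^ (r - 1 - j)) u) := by
    refine (homogeneousSpan_le_homogeneousSpan_add h.commute _).trans ?_
    rw [homogeneousSpan_le, Fintype.range_linearCombination]
    exact fun a b hab => Submodule.subset_span ⟨⟨a, by omega⟩, by simp [← hab]⟩
  refine (Submodule.finrank_mono (Submodule.map_mono hrange)).trans_lt ?_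
  rw [← LinearMap.range_comp, h.add_pow_comp_linearCombination hrm hrn, LinearMap.range_comp]
  refine (Submodule.finrank_map_le _ _).trans_lt ?_
  rw [Int.cast_det, ← LinearMap.det_toLin'] at hdet
  simpa using Submodule.finrank_lt (LinearMap.range_lt_top_of_det_eq_zero hdet).ne

lemma finrank_range_add_pow_lt (h : IsBicyclic X Y u m n) {r : ℕ} (hr : 1 ≤ r) (hrm : r ≤ m)
    (hrn : r ≤ n) (hdet : ((boxMatrix r (m - r) (n - r)).det : K) = 0) :
    Module.finrank K (LinearMap.range ((X + Y) ^ (m - r + (n - r)))) < r * r := by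
  have := h.finiteDimensional
  let A : ℕ → Submodule K M := fun d =>
    (homogeneousSpan X Y u d).map ((X + Y) ^ (m - r + (n - r)))
  have hbound : ∀ d, Module.finrank K (A d) ≤ min (d + 1) (2 * r - 1 - d) := fun d =>
    (h.finrank_map_add_pow_homogeneousSpan_le _ d).trans (by omega)
  have hrange : LinearMap.range ((X + Y) ^ (m - r + (n - r)))
      ≤ (Finset.range (2 * r - 1)).sup A := by
    rw [LinearMap.range_eq_map, ← h.iSup_homogeneousSpan_eq_top, Submodule.map_iSup]
    refine iSup_le fun d => ?_
    rcases lt_or_ge d (2 * r - 1) with hd | hd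
    · exact Finset.le_sup (f := A) (Finset.mem_range.2 hd)
    · have hzero : Module.finrank K (A d) = 0 := by have := hbound d; omega
      exact (Submodule.finrank_eq_zero.1 hzero).le.trans bot_le
  calc Module.finrank K (LinearMap.range ((X + Y) ^ (m - r + (n - r))))
      ≤ ∑ d ∈ Finset.range (2 * r - 1), Module.finrank K (A d) :=
        (Submodule.finrank_mono hrange).trans (finrank_finset_sup_le _ _)
    _ < ∑ d ∈ Finset.range (2 * r - 1), min (d + 1) (2 * r - 1 - d) := by
        refine Finset.sum_lt_sum (fun d _ => hbound d)
          ⟨r - 1, Finset.mem_range.2 (by omega), ?_⟩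
        exact (h.finrank_map_add_pow_homogeneousSpan_lt hr hrm hrn hdet).trans_le (by omega)
    _ = r * r := sum_range_min r

lemma exists_isJordanBasis_standardDim_iff (h : IsBicyclic X Y u m n) (hmn : m ≤ n) :
    (∃ w, IsJordanBasis (X + Y) (standardDim m n) w) ↔
      ∀ r, 1 ≤ r → r ≤ m → ((boxMatrix r (m - r) (n - r)).det : K) ≠ 0 := by
  refine ⟨fun ⟨w, hw⟩ r hr hrm hdet => ?_, h.exists_isJordanBasis hmn⟩
  have hlt := h.finrank_range_add_pow_lt hr hrm (hrm.trans hmn) hdet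
  rw [hw.finrank_range_pow, sum_standardDim_tsub hrm hmn] at hlt
  exact hlt.false

end IsBicyclic

end Bicyclic

/-! ### Tensor products -/

section TensorProduct

variable {K V W : Type*} [Field K] [AddCommGroup V] [Module K V] [AddCommGroup W] [Module K W]

lemma span_chain_eq_top [FiniteDimensional K V] {T : Module.End K V} {v : V}
    (hT : T ^ Module.finrank K V = 0) (hv : (T ^ (Module.finrank K V - 1)) v ≠ 0) :
    Submodule.span K (Set.range fun k : Fin (Module.finrank K V) => (T ^ (k : ℕ)) v) = ⊤ :=
  (linearIndependent_chain (by rw [hT, LinearMap.zero_apply])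
    hv).span_eq_top_of_card_eq_finrank' (Fintype.card_fin _)

lemma span_tmul_apply_eq_top {ι κ : Type*} {x : ι → V} {y : κ → W} {F : ι → Module.End K W}
    (hx : Submodule.span K (Set.range x) = ⊤) (hy : Submodule.span K (Set.range y) = ⊤)
    (hF : ∀ i, Function.Surjective (F i)) :
    Submodule.span K (Set.range fun k : ι × κ => x k.1 ⊗ₜ[K] F k.1 (y k.2)) = ⊤ := by
  set S := Submodule.span K (Set.range fun k : ι × κ => x k.1 ⊗ₜ[K] F k.1 (y k.2))
  have hleft : ∀ i z, x i ⊗ₜ[K] z ∈ S := by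
    intro i z
    obtain ⟨z, rfl⟩ := hF i z
    have hle : ⊤ ≤ S.comap (TensorProduct.mk K V W (x i) ∘ₗ F i) := by
      rw [← hy, Submodule.span_le, Set.range_subset_iff]
      exact fun j => Submodule.subset_span ⟨(i, j), rfl⟩
    exact hle (Submodule.mem_top (x := z))
  rw [eq_top_iff, ← TensorProduct.span_tmul_eq_top, Submodule.span_le]
  rintro _ ⟨v, z, rfl⟩
  have hle : ⊤ ≤ S.comap ((TensorProduct.mk K V W).flip z) := by
    rw [← hx, Submodule.span_le, Set.range_subset_iff]
    exact fun i => hleft i z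
  exact hle (Submodule.mem_top (x := v))

lemma isBicyclic_tensorProduct [FiniteDimensional K V] [FiniteDimensional K W]
    {N : Module.End K V} {N' P : Module.End K W} (hP : IsUnit P) (hPN' : Commute P N')
    {v : V} {w : W} (hN : N ^ Module.finrank K V = 0) (hN' : N' ^ Module.finrank K W = 0)
    (hv : (N ^ (Module.finrank K V - 1)) v ≠ 0) (hw : (N' ^ (Module.finrank K W - 1)) w ≠ 0) :
    IsBicyclic (TensorProduct.map N P) (TensorProduct.map 1 N') (v ⊗ₜ[K] w)
      (Module.finrank K V) (Module.finrank K W) := by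
  have hmonomial : ∀ a b : ℕ, ((TensorProduct.map N P : Module.End K (V ⊗[K] W)) ^ a
      * (TensorProduct.map 1 N' : Module.End K (V ⊗[K] W)) ^ b) (v ⊗ₜ[K] w)
        = (N ^ a) v ⊗ₜ[K] (P ^ a) ((N' ^ b) w) := by
    simp [TensorProduct.map_pow]
  have hsurj : ∀ i : Fin (Module.finrank K V), Function.Surjective (P ^ (i : ℕ)) := fun i =>
    ((Module.End.isUnit_iff _).1 (hP.pow _)).surjective
  have hspan := span_tmul_apply_eq_top (span_chain_eq_top hN hv) (span_chain_eq_top hN' hw) hsurj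
  simp only [← hmonomial] at hspan
  refine ⟨?_, ?_, ?_, linearIndependent_of_top_le_span_of_card_eq_finrank hspan.ge ?_, hspan⟩
  · rw [Commute, SemiconjBy, ← TensorProduct.map_mul, ← TensorProduct.map_mul, one_mul, mul_one,
      hPN'.eq]
  · rw [TensorProduct.map_pow, hN, TensorProduct.map_zero_left]
  · rw [TensorProduct.map_pow, hN', TensorProduct.map_zero_right]
  · rw [Fintype.card_prod, Fintype.card_fin, Fintype.card_fin, Module.finrank_tensorProduct]

lemma tprod_apply_sub_one {G : Type*} [Group G] (ρ : Representation K G V)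
    (σ : Representation K G W) (g : G) : (ρ.tprod σ) g - 1
      = TensorProduct.map (ρ g - 1) (σ g) + TensorProduct.map 1 (σ g - 1) := by
  refine TensorProduct.ext' fun x y => ?_
  simp [TensorProduct.tmul_sub, TensorProduct.sub_tmul]

end TensorProduct

end JordanPartition

theorem theorem2 {p : ℕ} (hp : p.Prime) (hp2 : p ≠ 2)
    {K : Type*} [Field K] [CharP K p]
    {G : Type*} [Group G] [IsCyclic G] {a : ℕ} (hG : Nat.card G = p ^ a)
    {V W : Type*} [AddCommGroup V] [Module K V] [AddCommGroup W] [Module K W]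
    (ρ : Representation K G V) (σ : Representation K G W)
    (hρ : JordanPartition.IsIndecomposable ρ) (hσ : JordanPartition.IsIndecomposable σ)
    {m n t : ℕ} (hm : Module.finrank K V = m) (hn : Module.finrank K W = n)
    (ht : 1 ≤ t) (hmt : p ^ t ≤ m) (hmt' : m < p ^ (t + 1)) (hmn : m ≤ n) :
    JordanPartition.IsStandard m n (JordanPartition.jordanPartition ρ σ) ↔
      (m, n) ∈ JordanPartition.standardPairs p t := by
  subst hm hn
  have := Fact.mk hp
  have hm0 := (pow_pos hp.pos t).trans_le hmt
  have : FiniteDimensional K V := Module.finite_of_finrank_pos hm0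
  have : FiniteDimensional K W := Module.finite_of_finrank_pos (hm0.trans_le hmn)
  have : Finite G := Nat.finite_of_card_ne_zero (hG ▸ pow_ne_zero a hp.ne_zero)
  obtain ⟨g, hg⟩ := IsCyclic.exists_generator (α := G)
  obtain ⟨hN, v, hv⟩ := hρ.exists_cyclic_vector hg (JordanPartition.isNilpotent_sub_one hG ρ g)
  obtain ⟨hN', w, hw⟩ := hσ.exists_cyclic_vector hg (JordanPartition.isNilpotent_sub_one hG σ g)
  have hbicyclic := JordanPartition.isBicyclic_tensorProduct ((Group.isUnit g).map σ)
    ((Commute.refl (σ g)).sub_right (Commute.one_right _)) hN hN' hv hw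
  rw [JordanPartition.jordanPartition,
    JordanPartition.isStandard_indecomposableDims_iff_exists_isJordanBasis hg
      (JordanPartition.isNilpotent_sub_one hG _ g) hm0 hmn,
    JordanPartition.tprod_apply_sub_one, hbicyclic.exists_isJordanBasis_standardDim_iff hmn,
    JordanPartition.forall_det_boxMatrix_ne_zero_iff p K,
    JordanPartition.forall_boxVanishes_pow_iff_mem_standardPairs (hp.odd_of_ne_two hp2) ht
      hmt hmt' hmn]
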